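/- All Hilbert spaces are finite-dimensional. Let $|\varphi_{AS}\rangle\in\mathcal H_A\otimes\mathcal H_S$ be a unit vector, $\varphi_S=\mathrm{tr}_A|\varphi\rangle\langle\varphi|$ the reference state, and let $\mathcal H_P$ be a Hilbert space with $\dim\mathcal H_P\ge\dim\mathcal H_S$ (for instance $\mathcal H_P=\mathcal H_A$ when $\dim\mathcal H_A=\dim\mathcal H_S$). For each $N$ let $k=k(N)\le N$ be the sample size, where $k(N)\ge\beta N$ for some $\beta>0$ and all large $N$, and put $n=N-k$. **Protocol (Purification-Based Sampling).** The prover prepares $\rho_{RS^N}$ and sends $S^N$ to the sampler. The sampler announces a uniformly random $t\subseteq[N]$ with $|t|=k$, the prover sends back registers $A_i$, $i\in t$, and the sampler accepts iff measuring $\{|\varphi\rangle\langle\varphi|,\mathrm{id}-|\varphi\rangle\langle\varphi|\}$ on each pair $A_iS_i$, $i\in t$, always gives $|\varphi\rangle\langle\varphi|$. An attack consists of a register $R$, a density operator $\rho_{RS^N}$, and, for each $t$, a completely positive trace-preserving map $\Lambda^t$ from $R$ to $A^k$. With $V^t:S^N\to S^kS^n$ the unitary that groups the registers $S_i$, $i\in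 t$, into $S^k$ and the others into $S^n$ (each in increasing order), the unnormalized output of the sampler on acceptance is $$\mathcal E^{\mathrm{acc}}(\rho_{RS^N})=\binom Nk^{-1}\sum_{t}\mathrm{tr}_{A^kS^k}\Big[\big(|\varphi\rangle\langle\varphi|^{\otimes k}_{A^kS^k}\otimes \mathrm{id}_{S^n}\big)\,V^t\,(\Lambda^t\otimes\mathrm{id}_{S^N})(\rho_{RS^N})\,V^{t\dagger}\Big].$$ For $\pi$ in a symmetric group $\mathfrak S_m$, let $\pi$ also denote the unitary $\pi(|x_1\rangle\otimes\dots\otimes|x_m\rangle)=|x_{\pi^{-1}(1)}\rangle\otimes\dots\otimes|x_{\pi^{-1}(m)}\rangle$. Let $\mathrm{Sym}^N(\mathcal H)$ be the subspace of $\mathcal H^{\otimes N}$ fixed by $\mathfrak S_N$, $F(\rho,\sigma)=\|\sqrt\rho\sqrt\sigma\|_1$ the fidelity, and $\Pi$ a register with orthonormal basis $\{|\pi\rangle\}_{\pi\in\mathfrak S_n}$. **Proposition.** The protocol is invariant under permutation of the sampler's registers. That is, there are functions $r_\varepsilon:\mathbb N\to\mathbb R$, $\varepsilon>0$, with $r_\varepsilon(N)=\Omega(N)$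 for each $\varepsilon$ (for some $c_\varepsilon>0$, $r_\varepsilon(N)\ge c_\varepsilon N$ for all large $N$), such that for every $N$ and every attack there is a completely positive trace non-increasing map $\bar{\mathcal E}^{\mathrm{acc}}$ from $P^NS^N$ to $\Pi S^n$ with the following properties. 1. For some $|\bar\rho_{P^NS^N}\rangle\in\mathrm{Sym}^N(\mathcal H_P\otimes\mathcal H_S)$ that is a purification of $\frac1{N!}\sum_{\pi\in\mathfrak S_N}\pi\,\rho_{S^N}\,\pi^\dagger$, where $\rho_{S^N}=\mathrm{tr}_R\,\rho_{RS^N}$, $$\frac1{n!}\sum_{\pi\in\mathfrak S_n}|\pi\rangle\langle\pi|_\Pi\otimes\pi\,\mathcal E^{\mathrm{acc}}(\rho_{RS^N})\,\pi^\dagger=\bar{\mathcal E}^{\mathrm{acc}}(|\bar\rho\rangle\langle\bar\rho|_{P^NS^N}).$$ 2. For every $\varepsilon>0$ and every unit vector $|\theta\rangle\in\mathcal H_P\otimes\mathcal H_S$ with reduced state $\theta_S=\mathrm{tr}_P|\theta\rangle\langle\theta|$ satisfying $F(\theta_S,\varphi_S)^2<1-\varepsilon$, one has $\|\bar{\mathcal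 E}^{\mathrm{acc}}(|\theta\rangle\langle\theta|^{\otimes N})\|_1\le\exp(-r_\varepsilon(N))$. 3. For every unit vector $|\theta\rangle\in\mathcal H_P\otimes\mathcal H_S$, $\mathrm{tr}_\Pi\,\bar{\mathcal E}^{\mathrm{acc}}(|\theta\rangle\langle\theta|^{\otimes N})\le\theta_S^{\otimes n}$ in the positive semidefinite order. -/

import Mathlib

open scoped Matrix Kronecker ComplexOrder MatrixOrder

noncomputable section

namespace QSampling

/-! Finite-dimensional Hilbert spaces are `X → ℂ` for a finite type `X` (an orthonormal basis);
operators are matrices, the composite of registers `X` and `Y` is indexed by `X × Y`, and `N` copies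
of a register `X` are indexed by `Fin N → X`. -/

section Basics

variable {X Y E : Type*} [Fintype X] [Fintype Y] [Fintype E]

/-- Density operators: positive semidefinite with trace one. -/
def IsDensity (ρ : Matrix X X ℂ) : Prop := ρ.PosSemidef ∧ ρ.trace = 1

/-- The operator `|ψ⟩⟨ψ|`. -/
def proj (ψ : X → ℂ) : Matrix X X ℂ := Matrix.vecMulVec ψ (star ψ)

/-- `ψ` is a unit vector. -/
def IsUnitVec (ψ : X → ℂ) : Prop := ∑ x, ‖ψ x‖ ^ 2 = 1

/-- Partial trace over the first register. -/
def traceFst (M : Matrix (X × Y) (X × Y) ℂ) : Matrix Y Y ℂ :=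
  Matrix.of fun y y' => ∑ x, M (x, y) (x, y')

/-- The trace norm `‖A‖₁ = tr √(A† A)`. -/
def traceNorm [DecidableEq X] (A : Matrix X X ℂ) : ℝ := (CFC.sqrt (Aᴴ * A)).trace.re

/-- The (non-squared) fidelity `F(ρ, σ) = ‖√ρ √σ‖₁`. -/
def fidelity [DecidableEq X] (ρ σ : Matrix X X ℂ) : ℝ := traceNorm (CFC.sqrt ρ * CFC.sqrt σ)

/-- The operator `(Φ ⊗ id_E)(M)`. -/
def ampliate (Φ : Matrix X X ℂ →ₗ[ℂ] Matrix Y Y ℂ) (M : Matrix (X × E) (X × E) ℂ) :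
    Matrix (Y × E) (Y × E) ℂ :=
  Matrix.of fun p q => Φ (Matrix.of fun x x' => M (x, p.2) (x', q.2)) p.1 q.1

/-- Complete positivity: `Φ ⊗ id` is positive for every finite-dimensional ancilla. -/
def IsCP (Φ : Matrix X X ℂ →ₗ[ℂ] Matrix Y Y ℂ) : Prop :=
  ∀ (m : ℕ) (M : Matrix (X × Fin m) (X × Fin m) ℂ), M.PosSemidef → (ampliate Φ M).PosSemidef

/-- Completely positive trace-preserving maps. -/
def IsCPTP (Φ : Matrix X X ℂ →ₗ[ℂ] Matrix Y Y ℂ) : Prop :=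
  IsCP Φ ∧ ∀ M, (Φ M).trace = M.trace

/-- Completely positive trace non-increasing maps. -/
def IsCPTNI (Φ : Matrix X X ℂ →ₗ[ℂ] Matrix Y Y ℂ) : Prop :=
  IsCP Φ ∧ ∀ M, M.PosSemidef → (Φ M).trace.re ≤ M.trace.re

end Basics

section Copies

variable {X : Type*} [Fintype X] [DecidableEq X] {N : ℕ}

/-- The vector `|θ⟩^{⊗N}`. -/
def vecPow (N : ℕ) (θ : X → ℂ) : (Fin N → X) → ℂ := fun x => ∏ i, θ (x i)

/-- The operator `ρ^{⊗N}`. -/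
def opPow (N : ℕ) (ρ : Matrix X X ℂ) : Matrix (Fin N → X) (Fin N → X) ℂ :=
  Matrix.of fun x y => ∏ i, ρ (x i) (y i)

/-- The unitary of a permutation, `π |x₁ … x_N⟩ = |x_{π⁻¹(1)} … x_{π⁻¹(N)}⟩`. -/
def permOp (π : Equiv.Perm (Fin N)) : Matrix (Fin N → X) (Fin N → X) ℂ :=
  Matrix.of fun x y => if x = y ∘ ⇑π⁻¹ then 1 else 0

/-- The conjugation `π M π†`. -/
def permConj (π : Equiv.Perm (Fin N)) (M : Matrix (Fin N → X) (Fin N → X) ℂ) :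
    Matrix (Fin N → X) (Fin N → X) ℂ :=
  permOp π * M * (permOp π)ᴴ

/-- The average `(1/N!) ∑_π π M π†`. -/
def symmetrize (M : Matrix (Fin N → X) (Fin N → X) ℂ) : Matrix (Fin N → X) (Fin N → X) ℂ :=
  ((N.factorial : ℂ)⁻¹) • ∑ π : Equiv.Perm (Fin N), permConj π M

/-- The symmetric subspace `Sym^N`: the span of the permutation invariant vectors. -/
def symSubspace (N : ℕ) (X : Type*) [Fintype X] [DecidableEq X] :
    Submodule ℂ ((Fin N → X) → ℂ) :=
  Submodule.span ℂ {ψ | ∀ π : Equiv.Perm (Fin N), permOp π *ᵥ ψ = ψ}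

/-- Partial trace over `P^N` of an operator on `(P ⊗ S)^{⊗N}`. -/
def tracePN {P S : Type*} [Fintype P]
    (M : Matrix (Fin N → P × S) (Fin N → P × S) ℂ) : Matrix (Fin N → S) (Fin N → S) ℂ :=
  Matrix.of fun s s' => ∑ p : Fin N → P, M (fun i => (p i, s i)) (fun i => (p i, s' i))

end Copies

/-- Samples: subsets of the `N` positions of size `k`. -/
abbrev Sample (N k : ℕ) : Type := {t : Finset (Fin N) // t.card = k}

/-- Positions regrouped according to a sample: those in `t` (in increasing order), then those
outside `t` (in increasing order). -/
def positions {N k : ℕ} (t : Sample N k) : Fin k ⊕ Fin (N - k) ≃ Fin N :=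
  finSumEquivOfFinset t.2 (by rw [Finset.card_compl, t.2, Fintype.card_fin])

/-- The regrouping `S^N → S^k S^n`, `n = N - k`, which puts the sampled registers first. -/
def group {N k : ℕ} (t : Sample N k) (S : Type*) :
    (Fin N → S) ≃ (Fin k → S) × (Fin (N - k) → S) :=
  ((positions t).symm.arrowCongr (Equiv.refl S)).trans (Equiv.sumArrowEquivProdArrow _ _ S)

/-- A sampling protocol on `N` registers `S` with sample size `k`. The sampler receives `S^N`,
announces a uniformly random sample `t` and a challenge `c` (with probability `prob t c`), receives
a register `Q`, and measures `Q S_t` with a binary measurement whose accepting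
element is `accept t c`. -/
structure SamplingProtocol.{u, v} (S : Type u) [Fintype S] [DecidableEq S] (N k : ℕ) where
  /-- challenges -/
  C : Type
  [fintypeC : Fintype C]
  /-- basis of the reply register -/
  Q : Type v
  [fintypeQ : Fintype Q]
  [decEqQ : DecidableEq Q]
  prob : Sample N k → C → ℝ
  prob_nonneg : ∀ t c, 0 ≤ prob t c
  prob_sum : ∀ t, ∑ c, prob t c = 1
  accept : Sample N k → C → Matrix (Q × (Fin k → S)) (Q × (Fin k → S)) ℂ
  accept_nonneg : ∀ t c, 0 ≤ accept t c
  accept_le_one : ∀ t c, accept t c ≤ 1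

attribute [instance] SamplingProtocol.fintypeC SamplingProtocol.fintypeQ SamplingProtocol.decEqQ

section Protocol

variable {S : Type*} [Fintype S] [DecidableEq S] {N k : ℕ}

/-- The operations of a cheating prover holding a register `R`: for each `t` and `c` an arbitrary
quantum channel from `R` to the reply register. -/
structure Strategy (prot : SamplingProtocol S N k) (R : Type*) [Fintype R] where
  op : Sample N k → prot.C → (Matrix R R ℂ →ₗ[ℂ] Matrix prot.Q prot.Q ℂ)
  isCPTP : ∀ t c, IsCPTP (op t c)

/-- The joint operator on `(Q S^k) S^n` before the measurement, for sample `t` and challenge `c`. -/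
def beforeMeasurement {prot : SamplingProtocol S N k} {R : Type*} [Fintype R]
    (A : Strategy prot R) (t : Sample N k) (c : prot.C)
    (ρ : Matrix (R × (Fin N → S)) (R × (Fin N → S)) ℂ) :
    Matrix ((prot.Q × (Fin k → S)) × (Fin (N - k) → S))
      ((prot.Q × (Fin k → S)) × (Fin (N - k) → S)) ℂ :=
  Matrix.reindex
    (((Equiv.refl prot.Q).prodCongr (group t S)).trans (Equiv.prodAssoc _ _ _).symm)
    (((Equiv.refl prot.Q).prodCongr (group t S)).trans (Equiv.prodAssoc _ _ _).symm)
    (ampliate (A.op t c) ρ)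

/-- The map `𝓔^acc` from `R S^N` to `S^n`: the subnormalized output state of the sampler on
acceptance. -/
def accMap {prot : SamplingProtocol S N k} {R : Type*} [Fintype R] (A : Strategy prot R)
    (ρ : Matrix (R × (Fin N → S)) (R × (Fin N → S)) ℂ) :
    Matrix (Fin (N - k) → S) (Fin (N - k) → S) ℂ :=
  ((N.choose k : ℂ)⁻¹) • ∑ t : Sample N k, ∑ c : prot.C, (prot.prob t c : ℂ) •
    traceFst ((prot.accept t c ⊗ₖ (1 : Matrix (Fin (N - k) → S) (Fin (N - k) → S) ℂ)) *
      beforeMeasurement A t c ρ)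

/-- `(1/n!) ∑_π |π⟩⟨π| ⊗ π M π†`. -/
def randomReorder {n : ℕ} (M : Matrix (Fin n → S) (Fin n → S) ℂ) :
    Matrix (Equiv.Perm (Fin n) × (Fin n → S)) (Equiv.Perm (Fin n) × (Fin n → S)) ℂ :=
  ((n.factorial : ℂ)⁻¹) • ∑ π : Equiv.Perm (Fin n),
    Matrix.single π π (1 : ℂ) ⊗ₖ permConj π M

end Protocol

section PermInv

variable (P : Type*) {S : Type*} [Fintype P] [DecidableEq P] [Fintype S] [DecidableEq S] {N n : ℕ}

/-- First criterion for the map `Ebar`, for an attack with initial state `ρ` and accepted output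
`out`. -/
def Criterion1 {R : Type*} [Fintype R]
    (ρ : Matrix (R × (Fin N → S)) (R × (Fin N → S)) ℂ)
    (out : Matrix (Fin n → S) (Fin n → S) ℂ)
    (Ebar : Matrix (Fin N → P × S) (Fin N → P × S) ℂ →ₗ[ℂ]
      Matrix (Equiv.Perm (Fin n) × (Fin n → S)) (Equiv.Perm (Fin n) × (Fin n → S)) ℂ) : Prop :=
  ∃ ψ ∈ symSubspace N (P × S),
    tracePN (proj ψ) = symmetrize (traceFst ρ) ∧ randomReorder out = Ebar (proj ψ)

/-- Second criterion, with the exponent `rate ε` for each `ε`. -/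
def Criterion2 (φS : Matrix S S ℂ) (rate : ℝ → ℝ)
    (Ebar : Matrix (Fin N → P × S) (Fin N → P × S) ℂ →ₗ[ℂ]
      Matrix (Equiv.Perm (Fin n) × (Fin n → S)) (Equiv.Perm (Fin n) × (Fin n → S)) ℂ) : Prop :=
  ∀ ε : ℝ, 0 < ε → ∀ θ : P × S → ℂ, IsUnitVec θ →
    fidelity (traceFst (proj θ)) φS ^ 2 < 1 - ε →
      traceNorm (Ebar (proj (vecPow N θ))) ≤ Real.exp (-rate ε)

/-- Third criterion. -/
def Criterion3
    (Ebar : Matrix (Fin N → P × S) (Fin N → P × S) ℂ →ₗ[ℂ]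
      Matrix (Equiv.Perm (Fin n) × (Fin n → S)) (Equiv.Perm (Fin n) × (Fin n → S)) ℂ) : Prop :=
  ∀ θ : P × S → ℂ, IsUnitVec θ →
    traceFst (Ebar (proj (vecPow N θ))) ≤ opPow n (traceFst (proj θ))

/-- Permutation invariance of a family of sampling protocols for the reference state `φS`, with
sample size `k N` out of `N`. The exponent `rate ε N` of the second criterion is `Ω(N)` for each
`ε > 0`, uniformly in the attack and in `θ`. -/
def PermutationInvariant (φS : Matrix S S ℂ) (k : ℕ → ℕ)
    (prot : ∀ N, SamplingProtocol S N (k N)) : Prop :=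
  ∃ rate : ℝ → ℕ → ℝ,
    (∀ ε : ℝ, 0 < ε → ∃ c : ℝ, 0 < c ∧ ∀ᶠ N : ℕ in Filter.atTop, c * N ≤ rate ε N) ∧
    ∀ (N : ℕ) (R : Type) [Fintype R] (A : Strategy (prot N) R)
      (ρ : Matrix (R × (Fin N → S)) (R × (Fin N → S)) ℂ), IsDensity ρ →
      ∃ Ebar : Matrix (Fin N → P × S) (Fin N → P × S) ℂ →ₗ[ℂ]
          Matrix (Equiv.Perm (Fin (N - k N)) × (Fin (N - k N) → S))
            (Equiv.Perm (Fin (N - k N)) × (Fin (N - k N) → S)) ℂ,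
        IsCPTNI Ebar ∧ Criterion1 P ρ (accMap A ρ) Ebar ∧
          Criterion2 P φS (fun ε => rate ε N) Ebar ∧ Criterion3 P Ebar

end PermInv

section Purification

variable {A S : Type*} [Fintype A] [Fintype S]

/-- The vector `|φ⟩^{⊗k}` arranged on the registers `A^k S^k`. -/
def pairedPow (k : ℕ) (φ : A × S → ℂ) : (Fin k → A) × (Fin k → S) → ℂ :=
  fun p => ∏ i, φ (p.1 i, p.2 i)

theorem isUnitVec_pairedPow (k : ℕ) {φ : A × S → ℂ} (hφ : IsUnitVec φ) :
    IsUnitVec (pairedPow k φ) := by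
  unfold IsUnitVec at *
  rw [← Equiv.sum_comp (Equiv.arrowProdEquivProdArrow (Fin k) (fun _ => A) (fun _ => S))]
  have h : ∀ x : Fin k → A × S, ‖pairedPow k φ (Equiv.arrowProdEquivProdArrow (Fin k)
      (fun _ => A) (fun _ => S) x)‖ ^ 2 = ∏ i, ‖φ (x i)‖ ^ 2 := by
    intro x
    simp [pairedPow, Equiv.arrowProdEquivProdArrow, Finset.prod_pow]
  rw [Finset.sum_congr rfl fun x _ => h x, ← Fintype.piFinset_univ,
    ← Finset.prod_univ_sum (fun _ => Finset.univ) fun _ x => ‖φ x‖ ^ 2]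
  simp [hφ]

theorem proj_nonneg {X : Type*} [Fintype X] (ψ : X → ℂ) : 0 ≤ proj ψ :=
  (Matrix.posSemidef_vecMulVec_self_star ψ).nonneg

theorem proj_le_one {X : Type*} [Fintype X] [DecidableEq X] {ψ : X → ℂ} (hψ : IsUnitVec ψ) :
    proj ψ ≤ 1 := by
  have hdot : star ψ ⬝ᵥ ψ = 1 := by
    have : ∀ x, star (ψ x) * ψ x = ((‖ψ x‖ ^ 2 : ℝ) : ℂ) := by
      intro x
      rw [Complex.star_def, ← Complex.normSq_eq_conj_mul_self, Complex.normSq_eq_norm_sq]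
    simp only [dotProduct, Pi.star_apply, this]
    rw [← Complex.ofReal_sum, hψ, Complex.ofReal_one]
  have hsq : proj ψ * proj ψ = proj ψ := by
    simp [proj, Matrix.vecMulVec_mul_vecMulVec, hdot]
  have hH : (proj ψ)ᴴ = proj ψ := (Matrix.posSemidef_vecMulVec_self_star ψ).isHermitian
  have key : (1 - proj ψ)ᴴ * (1 - proj ψ) = 1 - proj ψ := by
    rw [Matrix.conjTranspose_sub, hH, Matrix.conjTranspose_one, sub_mul, mul_sub, mul_sub, hsq]
    simp
  rw [Matrix.le_iff, ← key]
  exact Matrix.posSemidef_conjTranspose_mul_self _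

/-- Purification-based sampling with the agreed purification `φ` of the reference state
`tr_A |φ⟩⟨φ|`: there is no challenge, the prover replies with registers `A^k` (the `i`-th one is
supposed to purify the `i`-th sampled register), and the sampler accepts
if each pair is found in state `|φ⟩⟨φ|`, that is, on `|φ⟩⟨φ|^{⊗k}`. -/
def purificationSampling [DecidableEq A] [DecidableEq S] (φ : A × S → ℂ) (hφ : IsUnitVec φ) (N k : ℕ) :
    SamplingProtocol S N k where
  C := Unit
  Q := Fin k → A
  prob _ _ := 1
  prob_nonneg _ _ := zero_le_one
  prob_sum _ := by simp
  accept _ _ := proj (pairedPow k φ)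
  accept_nonneg _ _ := proj_nonneg _
  accept_le_one _ _ := proj_le_one (isUnitVec_pairedPow k hφ)

end Purification

end QSampling

end

open scoped Matrix Kronecker ComplexOrder MatrixOrder

/-! Fix one sample `t₀`. From an attack, form a state σ on Π A^k S^N: average over the announced
sample and over reorderings of the k tested pairs and of the n output registers, record the latter
order in Π, and move the registers so that the tested ones always sit in `t₀`. A random sample
together with the two random orders is exactly a uniform permutation of N positions, and the
prover's channels do not touch S^N, so the marginal of σ on S^N is the symmetrized ρ_S
(`traceFst_shuffledState`).

The standard purification of that marginal is permutation invariant, and σ, like every extension of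
the marginal, arises from it by a completely positive trace non-increasing map on P^N
(`exists_kraus_of_extension`). The map sought applies this map to P^N, projects A^k and the
registers in `t₀` onto φ^{⊗k}, and keeps Π and the other n registers. On the purification it gives
the reordered accepted output because φ^{⊗k} is unchanged when the pairs are permuted
(`sum_shuffledState`).

Only two facts then matter for θ^{⊗N}: the map on P^N is a contraction and nothing acts on S^n. The
latter bounds the output marginal by that of the input (`traceFst_krausMap_acceptKraus_le`). For the
acceptance probability, write ⟨φ| = ⟨L⁻¹φ|L with L Hermitian and invertible on S. Since L commutes
with anything done to P^N, Cauchy–Schwarz bounds the probability by (‖L⁻¹φ‖² ‖Lθ‖²)^k. By Alberti's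
formula L can be chosen with the base at most 1 - ε once F(θ_S, φ_S)² < 1 - ε
(`exists_invertible_trace_mul_le`), whence the rate εk. The prover's arbitrary joint reply costs
nothing, because L acts on the sampler's side alone. -/

namespace QSampling

set_option linter.unusedSectionVars false

/-! ### Square roots of matrices and Alberti's formula for the fidelity -/

section MatrixAnalysis

variable {X : Type*} [Fintype X] [DecidableEq X]

theorem sqrt_isHermitian (M : Matrix X X ℂ) : (CFC.sqrt M)ᴴ = CFC.sqrt M :=
  (Matrix.nonneg_iff_posSemidef.mp (CFC.sqrt_nonneg M)).isHermitian

theorem sqrt_mul_sqrt {M : Matrix X X ℂ} (hM : M.PosSemidef) : CFC.sqrt M * CFC.sqrt M = M :=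
  CFC.sqrt_mul_sqrt_self M hM.nonneg

theorem trace_mul_nonneg {M L : Matrix X X ℂ} (hM : M.PosSemidef) (hL : L.PosSemidef) :
    0 ≤ (M * L).trace := by
  have h := (hL.mul_mul_conjTranspose_same (CFC.sqrt M)).trace_nonneg
  rwa [Matrix.trace_mul_comm, sqrt_isHermitian, ← mul_assoc, sqrt_mul_sqrt hM] at h

theorem traceNorm_of_posSemidef {M : Matrix X X ℂ} (hM : M.PosSemidef) :
    traceNorm M = M.trace.re := by
  rw [traceNorm, hM.isHermitian.eq, CFC.sqrt_mul_self M hM.nonneg]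

/-- A Hermitian generalized inverse of `√τ`. -/
theorem exists_sqrt_pseudoinverse {τ : Matrix X X ℂ} (hτ : τ.PosSemidef) :
    ∃ C : Matrix X X ℂ, Cᴴ = C ∧ CFC.sqrt τ * C * CFC.sqrt τ = CFC.sqrt τ ∧
      (1 - C * τ * C).PosSemidef := by
  set D := CFC.sqrt τ with hD
  have hDsa : IsSelfAdjoint D := sqrt_isHermitian τ
  have hcont : ∀ f : ℝ → ℝ, ContinuousOn f (spectrum ℝ D) := fun f =>
    Matrix.finite_real_spectrum.continuousOn f
  set C := cfc (fun x : ℝ => x⁻¹) D with hC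
  have hCsa : Cᴴ = C := cfc_predicate (fun x : ℝ => x⁻¹) D
  have hid : cfc (fun x : ℝ => x) D = D := cfc_id' ℝ D
  have hDC : D * C = cfc (fun x : ℝ => x * x⁻¹) D := by
    rw [cfc_mul (fun x : ℝ => x) (fun x => x⁻¹) D (hcont _) (hcont _), hid]
  have hCD : C * D = D * C := by
    rw [hDC, ← funext fun x : ℝ => mul_comm x⁻¹ x,
      cfc_mul (fun x : ℝ => x⁻¹) (fun x => x) D (hcont _) (hcont _), hid]
  have hDCD : D * C * D = D := by
    have h := cfc_mul (fun x : ℝ => x * x⁻¹) (fun x => x) D (hcont _) (hcont _)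
    rw [← hDC, hid] at h
    rw [← h]
    simp only [mul_inv_mul_cancel]
    exact hid
  refine ⟨C, hCsa, hDCD, ?_⟩
  -- `D * C` is the orthogonal projection onto the support of `τ`.
  have hproj : C * τ * C = D * C := by
    rw [← sqrt_mul_sqrt hτ, ← hD, ← mul_assoc, hCD, mul_assoc, ← mul_assoc, hDCD]
  have hsq : D * C * (D * C) = D * C := by rw [← mul_assoc, hDCD]
  have hH : (D * C)ᴴ = D * C := by rw [Matrix.conjTranspose_mul, hCsa, show Dᴴ = D from hDsa, hCD]
  have key : (1 - D * C)ᴴ * (1 - D * C) = 1 - D * C := by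
    rw [Matrix.conjTranspose_sub, hH, Matrix.conjTranspose_one, sub_mul, mul_sub, mul_sub, hsq]
    simp
  rw [hproj, ← key]
  exact Matrix.posSemidef_conjTranspose_mul_self _

/-- Approximate optimality in Alberti's theorem
`F(ρ, σ)² = inf_X tr (X ρ) tr (X⁻¹ σ)`. -/
theorem exists_posDef_trace_le {ρ σ : Matrix X X ℂ} (hρ : ρ.PosSemidef) (hσ : σ.PosSemidef)
    {δ : ℝ} (hδ : 0 < δ) :
    ∃ M : Matrix X X ℂ, M.PosDef ∧ (M * ρ).trace.re ≤ fidelity ρ σ + δ * ρ.trace.re ∧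
      (M⁻¹ * σ).trace.re ≤ fidelity ρ σ + δ * Fintype.card X := by
  set s := CFC.sqrt σ with hs
  have hsH : sᴴ = s := sqrt_isHermitian σ
  have hss : s * s = σ := sqrt_mul_sqrt hσ
  set T := CFC.sqrt ((CFC.sqrt ρ * s)ᴴ * (CFC.sqrt ρ * s)) with hT
  have hTpsd : T.PosSemidef := Matrix.nonneg_iff_posSemidef.mp (CFC.sqrt_nonneg _)
  have hTT : T * T = s * ρ * s := by
    rw [hT, sqrt_mul_sqrt (Matrix.posSemidef_conjTranspose_mul_self _),
      Matrix.conjTranspose_mul (CFC.sqrt ρ) s, sqrt_isHermitian ρ, hsH]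
    rw [← mul_assoc, mul_assoc s, sqrt_mul_sqrt hρ]
  have hF : fidelity ρ σ = T.trace.re := rfl
  have hδ1 : ((δ : ℂ) • (1 : Matrix X X ℂ)).PosDef :=
    Matrix.PosDef.one.smul (by exact_mod_cast hδ)
  -- With T = |√ρ√σ|, the formal optimizer is M = √σ T⁻¹ √σ, which makes both traces equal to tr T =
  -- F(ρ, σ). Adding δ to T, and again to M below, makes the inverses exist.
  set H := T + (δ : ℂ) • (1 : Matrix X X ℂ) with hH
  have hHpd : H.PosDef := Matrix.PosDef.posSemidef_add hTpsd hδ1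
  set W := CFC.sqrt H with hW
  have hWH : Wᴴ = W := sqrt_isHermitian H
  have hWW : W * W = H := sqrt_mul_sqrt hHpd.posSemidef
  have hWu : IsUnit W.det := by
    have h := (Matrix.isUnit_iff_isUnit_det _).mp hHpd.isUnit
    rw [← hWW, Matrix.det_mul] at h
    exact isUnit_of_mul_isUnit_left h
  have hHu : IsUnit H.det := (Matrix.isUnit_iff_isUnit_det _).mp hHpd.isUnit
  have hWi : W⁻¹ * W⁻¹ = H⁻¹ := by rw [← Matrix.mul_inv_rev, hWW]
  have hWiH : (W⁻¹)ᴴ = W⁻¹ := by rw [Matrix.conjTranspose_nonsing_inv, hWH]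
  set Z := s * W⁻¹ with hZ
  have hZH : Zᴴ = W⁻¹ * s := by rw [hZ, Matrix.conjTranspose_mul, hWiH, hsH]
  have hZW : Z * W = s := by rw [hZ, mul_assoc, Matrix.nonsing_inv_mul _ hWu, mul_one]
  set M := Z * Zᴴ + (δ : ℂ) • (1 : Matrix X X ℂ) with hM
  have hMpd : M.PosDef :=
    Matrix.PosDef.posSemidef_add (Matrix.posSemidef_self_mul_conjTranspose Z) hδ1
  have hMu : IsUnit M.det := (Matrix.isUnit_iff_isUnit_det _).mp hMpd.isUnit
  refine ⟨M, hMpd, ?_, ?_⟩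
  · have h1 : (M * ρ).trace = (H⁻¹ * (T * T)).trace + δ * ρ.trace := by
      rw [hM, add_mul, Matrix.trace_add, hZH, hZ, hTT, Matrix.smul_mul, one_mul,
        Matrix.trace_smul, smul_eq_mul, ← hWi]
      congr 1
      rw [show s * W⁻¹ * (W⁻¹ * s) * ρ = s * (W⁻¹ * W⁻¹ * (s * ρ)) by simp only [mul_assoc],
        Matrix.trace_mul_comm]
      simp only [mul_assoc]
    have h2 : H⁻¹ * (T * T) = T - (δ : ℂ) • (H⁻¹ * T) := by
      have : T = H - (δ : ℂ) • (1 : Matrix X X ℂ) := by rw [hH]; simp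
      rw [← mul_assoc]
      nth_rewrite 1 [this]
      rw [mul_sub, Matrix.nonsing_inv_mul _ hHu, sub_mul]
      simp
    have h3 := (Complex.nonneg_iff.mp (trace_mul_nonneg hHpd.inv.posSemidef hTpsd)).1
    rw [h1, h2, Matrix.trace_sub, Matrix.trace_smul, hF]
    simp only [Complex.add_re, Complex.sub_re, smul_eq_mul, Complex.re_ofReal_mul]
    nlinarith
  -- Since σ = Z H Z†, tr(M⁻¹σ) = tr(H D). It remains to see that D ≤ 1, which gives the bound tr H
  -- = F + δ dim.
  · set D := Zᴴ * M⁻¹ * Z with hD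
    have hMiH : (M⁻¹)ᴴ = M⁻¹ := hMpd.inv.isHermitian
    have hDH : Dᴴ = D := by
      rw [hD, Matrix.conjTranspose_mul (Zᴴ * M⁻¹) Z, Matrix.conjTranspose_mul Zᴴ M⁻¹, hMiH,
        Matrix.conjTranspose_conjTranspose, mul_assoc]
    have hDD : D - D * D = (δ : ℂ) • ((M⁻¹ * Z)ᴴ * (M⁻¹ * Z)) := by
      have hZZ : Z * Zᴴ = M - (δ : ℂ) • (1 : Matrix X X ℂ) := by rw [hM]; simp
      have : D * D = Zᴴ * (M⁻¹ * (Z * Zᴴ) * M⁻¹) * Z := by rw [hD]; simp only [mul_assoc]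
      rw [this, hZZ, mul_sub, Matrix.nonsing_inv_mul _ hMu,
        Matrix.conjTranspose_mul M⁻¹ Z, hMiH, hD]
      simp only [sub_mul, mul_sub, one_mul, mul_assoc, Matrix.mul_smul, Matrix.smul_mul, mul_one]
      abel
    have hD1 : (1 - D).PosSemidef := by
      have : 1 - D = (1 - D)ᴴ * (1 - D) + (D - D * D) := by
        rw [Matrix.conjTranspose_sub, Matrix.conjTranspose_one, hDH]
        noncomm_ring
      rw [this, hDD]
      exact (Matrix.posSemidef_conjTranspose_mul_self _).add
        ((Matrix.posSemidef_conjTranspose_mul_self _).smul (by exact_mod_cast hδ.le))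
    have h1 : (M⁻¹ * σ).trace = (H * D).trace := by
      have : σ = Z * (H * Zᴴ) := by
        rw [← hWW, hZH, show Z * (W * W * (W⁻¹ * s)) = (Z * W) * ((W * W⁻¹) * s) by
          simp only [mul_assoc], Matrix.mul_nonsing_inv _ hWu, hZW, one_mul, hss]
      rw [this, ← mul_assoc, Matrix.trace_mul_comm, hD]
      simp only [mul_assoc]
    have h2 := (Complex.nonneg_iff.mp (trace_mul_nonneg hHpd.posSemidef hD1)).1
    rw [mul_sub, mul_one, Matrix.trace_sub, Complex.sub_re] at h2
    rw [h1, hF]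
    have h3 : H.trace.re = T.trace.re + δ * Fintype.card X := by
      rw [hH, Matrix.trace_add, Matrix.trace_smul, Matrix.trace_one]
      simp
    linarith

/-- The strict inequality leaves room for the error δ in the approximate optimizer M; then Y = √M
turns the two traces into squared norms of filtered purifications. -/
theorem exists_invertible_trace_mul_le {ρ σ : Matrix X X ℂ} (hρ : ρ.PosSemidef)
    (hσ : σ.PosSemidef) {c : ℝ} (hc : fidelity ρ σ ^ 2 < c) :
    ∃ Y : Matrix X X ℂ, Yᴴ = Y ∧ IsUnit Y.det ∧
      (Y * ρ * Yᴴ).trace.re * (Y⁻¹ * σ * Y⁻¹ᴴ).trace.re ≤ c := by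
  have hlim : Filter.Tendsto (fun δ : ℝ => (fidelity ρ σ + δ * ρ.trace.re) *
      (fidelity ρ σ + δ * Fintype.card X)) (nhdsWithin 0 (Set.Ioi 0))
      (nhds (fidelity ρ σ ^ 2)) := by
    have : Continuous (fun δ : ℝ => (fidelity ρ σ + δ * ρ.trace.re) *
      (fidelity ρ σ + δ * Fintype.card X)) := by fun_prop
    have h := this.tendsto 0
    simp only [zero_mul, add_zero, ← sq] at h
    exact h.mono_left nhdsWithin_le_nhds
  obtain ⟨δ, hδc, hδ⟩ := ((hlim.eventually_lt_const hc).and self_mem_nhdsWithin).exists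
  obtain ⟨M, hM, h1, h2⟩ := exists_posDef_trace_le hρ hσ hδ
  have hY := sqrt_isHermitian M
  have hYY := sqrt_mul_sqrt hM.posSemidef
  refine ⟨CFC.sqrt M, hY, ?_, ?_⟩
  · have h := (Matrix.isUnit_iff_isUnit_det _).mp hM.isUnit
    rw [← hYY, Matrix.det_mul] at h
    exact isUnit_of_mul_isUnit_left h
  · rw [Matrix.conjTranspose_nonsing_inv, hY, Matrix.trace_mul_comm, ← mul_assoc, hYY,
      Matrix.trace_mul_comm (_ * σ), ← mul_assoc, ← Matrix.mul_inv_rev, hYY]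
    refine le_trans ?_ hδc.le
    have h3 := (Complex.nonneg_iff.mp (trace_mul_nonneg hM.inv.posSemidef hσ)).1
    have h4 := (Complex.nonneg_iff.mp (trace_mul_nonneg hM.posSemidef hρ)).1
    gcongr
    linarith

end MatrixAnalysis

/-! ### Extensions of a state from its standard purification -/

section Extensions

variable {E Z P : Type*} [Fintype E] [Fintype Z] [Fintype P]

theorem ofReal_sum_norm_sq {X : Type*} [Fintype X] (v : X → ℂ) :
    ((∑ x, ‖v x‖ ^ 2 : ℝ) : ℂ) = v ⬝ᵥ star v := by
  simp [dotProduct, Complex.mul_conj']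

theorem ofReal_sum_norm_sq_vecMul {X Y : Type*} [Fintype X] [Fintype Y] (v : X → ℂ)
    (G : Matrix X Y ℂ) :
    ((∑ y, ‖(v ᵥ* G) y‖ ^ 2 : ℝ) : ℂ) = v ⬝ᵥ (G * Gᴴ) *ᵥ star v := by
  rw [ofReal_sum_norm_sq, Matrix.star_vecMul, Matrix.dotProduct_mulVec,
    Matrix.dotProduct_mulVec, Matrix.vecMul_vecMul]

theorem trace_one_kronecker_mul [DecidableEq E] (B : Matrix Z Z ℂ) (σ : Matrix (E × Z) (E × Z) ℂ) :
    (((1 : Matrix E E ℂ) ⊗ₖ B) * σ).trace = (B * traceFst σ).trace := by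
  simp only [Matrix.trace, Matrix.diag_apply, Matrix.mul_apply, Fintype.sum_prod_type,
    Matrix.kroneckerMap_apply, Matrix.one_apply, traceFst, Matrix.of_apply, ite_mul, one_mul,
    zero_mul, Finset.mul_sum]
  rw [Finset.sum_comm]
  refine Finset.sum_congr rfl fun z _ => ?_
  rw [Finset.sum_comm (s := Finset.univ (α := Z))]
  refine Finset.sum_congr rfl fun e _ => ?_
  rw [Finset.sum_eq_single e]
  · simp
  · intro e' _ h
    simp [h.symm]
  · simp

theorem traceFst_posSemidef {X Y : Type*} [Fintype X] {σ : Matrix (X × Y) (X × Y) ℂ}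
    (hσ : σ.PosSemidef) :
    (traceFst σ).PosSemidef := by
  have : traceFst σ = ∑ e, σ.submatrix (fun z => (e, z)) (fun z => (e, z)) := by
    ext z z'
    simp [traceFst, Matrix.sum_apply]
  rw [this]
  exact Matrix.posSemidef_sum _ fun e _ => hσ.submatrix _

/-- A positive operator is supported on the support of its marginal. -/
theorem one_kronecker_mul_sqrt [DecidableEq E] [DecidableEq Z]
    {σ : Matrix (E × Z) (E × Z) ℂ} (hσ : σ.PosSemidef)
    {L : Matrix Z Z ℂ} (hL : L * traceFst σ = traceFst σ) :
    ((1 : Matrix E E ℂ) ⊗ₖ L) * CFC.sqrt σ = CFC.sqrt σ := by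
  set B := (1 : Matrix E E ℂ) ⊗ₖ (1 - L) with hB
  -- The squared Hilbert–Schmidt norm of B√σ is tr(B†Bσ), which only sees the marginal τ of σ, and
  -- (1 - L)τ = 0.
  have hzero : B * CFC.sqrt σ = 0 := by
    rw [← Matrix.trace_mul_conjTranspose_self_eq_zero_iff, Matrix.conjTranspose_mul,
      sqrt_isHermitian, ← mul_assoc, mul_assoc B, sqrt_mul_sqrt hσ, Matrix.trace_mul_comm,
      ← mul_assoc, hB, Matrix.conjTranspose_kronecker, ← Matrix.mul_kronecker_mul,
      Matrix.conjTranspose_one, one_mul, trace_one_kronecker_mul, mul_assoc, sub_mul, hL]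
    simp
  have h1 : (1 : Matrix E E ℂ) ⊗ₖ L = 1 - B := by
    rw [eq_sub_iff_add_eq, hB, ← Matrix.kronecker_add, add_sub_cancel, Matrix.one_kronecker_one]
  rw [h1, sub_mul, hzero, one_mul, sub_zero]

/-- Every extension `σ` of `τ = tr_E σ` is obtained from the standard purification
`∑_z |z⟩ ⊗ √τ |z⟩` by a completely positive trace non-increasing map on the purifying system. -/
theorem exists_kraus_of_extension_aux [DecidableEq E] [DecidableEq Z]
    {σ : Matrix (E × Z) (E × Z) ℂ} (hσ : σ.PosSemidef) :
    ∃ K : E × Z → Matrix E Z ℂ,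
      (∀ v : Z → ℂ, ∑ w, ∑ e, ‖∑ z, K w e z * v z‖ ^ 2 ≤ ∑ z, ‖v z‖ ^ 2) ∧
      ∀ w e z, ∑ z', K w e z' * CFC.sqrt (traceFst σ) z z' = CFC.sqrt σ (e, z) w := by
  obtain ⟨C, hC, hDCD, hle⟩ := exists_sqrt_pseudoinverse (traceFst_posSemidef hσ)
  set D := CFC.sqrt (traceFst σ) with hD
  have hDD : D * D = traceFst σ := sqrt_mul_sqrt (traceFst_posSemidef hσ)
  -- `Q e` is the block of rows of √σ with first index `e`. The Kraus operators are the blocks C Q_e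
  -- with the roles of the indices transposed: C undoes √τ, and C τ C ≤ 1 makes them jointly
  -- contractive.
  let Q : E → Matrix Z (E × Z) ℂ := fun e => Matrix.of fun z w => CFC.sqrt σ (e, z) w
  have hQ : ∑ e, Q e * (Q e)ᴴ = traceFst σ := by
    ext z z'
    rw [Matrix.sum_apply]
    simp only [traceFst, Matrix.of_apply]
    refine Finset.sum_congr rfl fun e _ => ?_
    conv_rhs => rw [← sqrt_mul_sqrt hσ]
    rw [Matrix.mul_apply, Matrix.mul_apply]
    refine Finset.sum_congr rfl fun w _ => ?_
    conv_rhs => rw [← sqrt_isHermitian σ]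
    nth_rewrite 1 [sqrt_isHermitian σ]
    rfl
  refine ⟨fun w => Matrix.of fun e z => (C * Q e) z w, fun v => ?_, fun w e z => ?_⟩
  · have h1 : ∀ w e, ∑ z, (C * Q e) z w * v z = (v ᵥ* (C * Q e)) w := fun w e => by
      simp only [Matrix.vecMul, dotProduct, mul_comm]
    simp only [Matrix.of_apply, h1]
    rw [Finset.sum_comm, ← Complex.real_le_real, Complex.ofReal_sum]
    simp only [ofReal_sum_norm_sq_vecMul]
    rw [← dotProduct_sum, ← Matrix.sum_mulVec, ofReal_sum_norm_sq]
    have h2 : ∑ e, C * Q e * (C * Q e)ᴴ = C * traceFst σ * C := by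
      rw [← hQ, Finset.mul_sum, Finset.sum_mul]
      refine Finset.sum_congr rfl fun e _ => ?_
      rw [Matrix.conjTranspose_mul, hC]
      simp only [Matrix.mul_assoc]
    rw [h2]
    have h3 := hle.dotProduct_mulVec_nonneg (star v)
    rw [Matrix.sub_mulVec, Matrix.one_mulVec, dotProduct_sub, star_star] at h3
    exact sub_nonneg.mp h3
  · have h1 : D * C * traceFst σ = traceFst σ := by rw [← hDD, ← mul_assoc, hDCD]
    have h2 := congrFun (congrFun (one_kronecker_mul_sqrt hσ h1) (e, z)) w
    rw [← h2, Matrix.mul_apply, Fintype.sum_prod_type, Finset.sum_eq_single e]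
    · simp only [Matrix.of_apply, Matrix.kroneckerMap_apply, Matrix.one_apply_eq, one_mul]
      have h3 : ∑ z', (C * Q e) z' w * D z z' = (D * (C * Q e)) z w := by
        simp only [Matrix.mul_apply (M := D), mul_comm]
      rw [h3, ← Matrix.mul_assoc, Matrix.mul_apply]
      rfl
    · intro e' _ h
      simp [h.symm]
    · simp

theorem sum_extend_mul {j : Z → P} (hj : Function.Injective j) (f : Z → ℂ) (v : P → ℂ) :
    ∑ p, Function.extend j f 0 p * v p = ∑ z, f z * v (j z) := by
  classical
  rw [← Finset.sum_subset (Finset.subset_univ (Finset.univ.image j)),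
    Finset.sum_image fun _ _ _ _ h => hj h]
  · simp [hj.extend_apply]
  · intro p _ hp
    rw [Function.extend_apply']
    · simp
    · simpa using hp

theorem sum_comp_le {j : Z → P} (hj : Function.Injective j) {f : P → ℝ} (hf : ∀ p, 0 ≤ f p) :
    ∑ z, f (j z) ≤ ∑ p, f p := by
  classical
  rw [← Finset.sum_image (s := Finset.univ) (g := j) fun _ _ _ _ h => hj h]
  exact Finset.sum_le_sum_of_subset_of_nonneg (Finset.subset_univ _) fun p _ _ => hf p

/-- Allows a larger purifying system: the Kraus operators are extended by zero off the range of `j`.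
-/
theorem exists_kraus_of_extension [DecidableEq E] [DecidableEq Z]
    {σ : Matrix (E × Z) (E × Z) ℂ} (hσ : σ.PosSemidef)
    {j : Z → P} (hj : Function.Injective j) :
    ∃ K : E × Z → Matrix E P ℂ,
      (∀ v : P → ℂ, ∑ w, ∑ e, ‖∑ p, K w e p * v p‖ ^ 2 ≤ ∑ p, ‖v p‖ ^ 2) ∧
      ∀ w e z, ∑ p, K w e p * Function.extend j (CFC.sqrt (traceFst σ) z) 0 p =
        CFC.sqrt σ (e, z) w := by
  obtain ⟨K, hK, hKσ⟩ := exists_kraus_of_extension_aux hσ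
  refine ⟨fun w => Matrix.of fun e => Function.extend j (K w e) 0, fun v => ?_, fun w e z => ?_⟩
  · simp only [Matrix.of_apply, sum_extend_mul hj]
    exact (hK _).trans (sum_comp_le hj (f := fun p => ‖v p‖ ^ 2) fun p => by positivity)
  · simp only [Matrix.of_apply, sum_extend_mul hj, hj.extend_apply, hKσ]

end Extensions

/-! ### Maps in Kraus form -/

section Kraus

variable {W X Y : Type*} [Fintype W] [Fintype X] [Fintype Y]

/-- The map with Kraus operators `G w`. -/
def krausMap (G : W → Matrix Y X ℂ) : Matrix X X ℂ →ₗ[ℂ] Matrix Y Y ℂ where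
  toFun M := ∑ w, G w * M * (G w)ᴴ
  map_add' M L := by simp [Matrix.mul_add, Matrix.add_mul, Finset.sum_add_distrib]
  map_smul' c M := by simp [Finset.smul_sum]

theorem krausMap_apply (G : W → Matrix Y X ℂ) (M : Matrix X X ℂ) :
    krausMap G M = ∑ w, G w * M * (G w)ᴴ := rfl

theorem posSemidef_krausMap (G : W → Matrix Y X ℂ) {M : Matrix X X ℂ} (hM : M.PosSemidef) :
    (krausMap G M).PosSemidef :=
  Matrix.posSemidef_sum _ fun w _ => hM.mul_mul_conjTranspose_same (G w)

theorem isCP_krausMap (G : W → Matrix Y X ℂ) : IsCP (krausMap G) := by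
  intro m M hM
  have h : ampliate (krausMap G) M =
      krausMap (fun w => G w ⊗ₖ (1 : Matrix (Fin m) (Fin m) ℂ)) M := by
    ext ⟨y, i⟩ ⟨y', i'⟩
    simp only [ampliate, krausMap_apply, Matrix.of_apply, Matrix.sum_apply]
    refine Finset.sum_congr rfl fun w _ => ?_
    simp [Matrix.mul_apply, Fintype.sum_prod_type, Matrix.one_apply, apply_ite (starRingEnd ℂ)]
  rw [h]
  exact posSemidef_krausMap _ hM

theorem krausMap_proj (G : W → Matrix Y X ℂ) (ψ : X → ℂ) :
    krausMap G (proj ψ) = ∑ w, proj (G w *ᵥ ψ) := by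
  rw [krausMap_apply]
  refine Finset.sum_congr rfl fun w _ => ?_
  rw [proj, proj, Matrix.mul_vecMulVec, Matrix.vecMulVec_mul, Matrix.star_mulVec]

theorem trace_proj (ψ : X → ℂ) : (proj ψ).trace = ((∑ x, ‖ψ x‖ ^ 2 : ℝ) : ℂ) := by
  rw [proj, Matrix.trace_vecMulVec, ofReal_sum_norm_sq]

theorem trace_re_krausMap_proj (G : W → Matrix Y X ℂ) (ψ : X → ℂ) :
    (krausMap G (proj ψ)).trace.re = ∑ w, ∑ y, ‖(G w *ᵥ ψ) y‖ ^ 2 := by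
  rw [krausMap_proj, Matrix.trace_sum, Complex.re_sum]
  simp only [trace_proj, Complex.ofReal_re]

theorem eq_sum_proj [DecidableEq X] {M : Matrix X X ℂ} (hM : M.PosSemidef) :
    M = ∑ x, proj fun x' => CFC.sqrt M x' x := by
  conv_lhs => rw [← sqrt_mul_sqrt hM]
  nth_rewrite 2 [← sqrt_isHermitian M]
  ext a b
  simp [Matrix.mul_apply, proj, Matrix.vecMulVec_apply, Matrix.sum_apply]

theorem isCPTNI_krausMap [DecidableEq X] {G : W → Matrix Y X ℂ}
    (hG : ∀ ψ : X → ℂ, ∑ w, ∑ y, ‖(G w *ᵥ ψ) y‖ ^ 2 ≤ ∑ x, ‖ψ x‖ ^ 2) :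
    IsCPTNI (krausMap G) := by
  refine ⟨isCP_krausMap G, fun M hM => ?_⟩
  rw [eq_sum_proj hM, map_sum, Matrix.trace_sum, Matrix.trace_sum, Complex.re_sum, Complex.re_sum]
  refine Finset.sum_le_sum fun x _ => ?_
  rw [trace_re_krausMap_proj, trace_proj, Complex.ofReal_re]
  exact hG _

theorem trace_traceFst (M : Matrix (X × Y) (X × Y) ℂ) : (traceFst M).trace = M.trace := by
  simp only [Matrix.trace, traceFst, Matrix.diag_apply, Matrix.of_apply, Fintype.sum_prod_type]
  exact Finset.sum_comm

/-- Reduces operator inequalities between marginals of pure states to inequalities between norms of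
partially contracted vectors. -/
theorem dotProduct_traceFst_proj (g : X × Y → ℂ) (v : Y → ℂ) :
    star v ⬝ᵥ traceFst (proj g) *ᵥ v = ((∑ x, ‖∑ y, star (v y) * g (x, y)‖ ^ 2 : ℝ) : ℂ) := by
  rw [ofReal_sum_norm_sq]
  simp only [dotProduct, Matrix.mulVec, traceFst, proj, Matrix.of_apply, Matrix.vecMulVec_apply,
    Pi.star_apply, star_sum, star_mul', star_star, Finset.mul_sum, Finset.sum_mul]
  conv_lhs => enter [2, y]; rw [Finset.sum_comm]
  rw [Finset.sum_comm]
  refine Finset.sum_congr rfl fun x _ => ?_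
  rw [Finset.sum_comm]
  refine Finset.sum_congr rfl fun y _ => Finset.sum_congr rfl fun y' _ => ?_
  ring

theorem traceFst_sum {ι : Type*} (s : Finset ι) (M : ι → Matrix (X × Y) (X × Y) ℂ) :
    traceFst (∑ i ∈ s, M i) = ∑ i ∈ s, traceFst (M i) := by
  ext y y'
  simp only [traceFst, Matrix.of_apply, Matrix.sum_apply]
  exact Finset.sum_comm

end Kraus

/-! ### The accepting map and its two bounds -/

section Acceptance

variable {W B Q P X Y V : Type*} [Fintype W] [Fintype B] [Fintype Q] [Fintype P] [Fintype X]
  [Fintype Y] [Fintype V]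

theorem norm_sum_star_mul_sq_le {X : Type*} [Fintype X] (u v : X → ℂ) :
    ‖∑ x, star (u x) * v x‖ ^ 2 ≤ (∑ x, ‖u x‖ ^ 2) * ∑ x, ‖v x‖ ^ 2 := by
  have h1 : ‖∑ x, star (u x) * v x‖ ≤ ∑ x, ‖u x‖ * ‖v x‖ :=
    (norm_sum_le _ _).trans_eq (by simp)
  exact (pow_le_pow_left₀ (norm_nonneg _) h1 2).trans
    (Finset.sum_mul_sq_le_sq_mul_sq _ _ _)

/-- Projecting the reply of a contraction onto `u` multiplies the squared norm by at most `‖u‖²`. -/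
theorem sum_norm_sq_overlap_le {K : W → Matrix (B × Q) P ℂ}
    (hK : ∀ v : P → ℂ, ∑ w, ∑ e, ‖∑ p, K w e p * v p‖ ^ 2 ≤ ∑ p, ‖v p‖ ^ 2)
    (u : Q × X → ℂ) (Ω : P → X → ℂ) :
    ∑ w, ∑ b, ‖∑ q : Q × X, star (u q) * ∑ p, K w (b, q.1) p * Ω p q.2‖ ^ 2 ≤
      (∑ q, ‖u q‖ ^ 2) * ∑ p, ∑ x, ‖Ω p x‖ ^ 2 := by
  calc _ ≤ ∑ w, ∑ b, (∑ q, ‖u q‖ ^ 2) *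
        ∑ q : Q × X, ‖∑ p, K w (b, q.1) p * Ω p q.2‖ ^ 2 :=
        Finset.sum_le_sum fun w _ => Finset.sum_le_sum fun b _ => norm_sum_star_mul_sq_le _ _
    _ = (∑ q, ‖u q‖ ^ 2) *
        ∑ x, ∑ w, ∑ e, ‖∑ p, K w e p * Ω p x‖ ^ 2 := by
        simp only [← Finset.mul_sum, Fintype.sum_prod_type]
        congr 1
        rw [Finset.sum_comm (s := Finset.univ (α := X))]
        refine Finset.sum_congr rfl fun w _ => ?_
        rw [Finset.sum_comm (s := Finset.univ (α := X))]
        refine Finset.sum_congr rfl fun b _ => ?_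
        rw [Finset.sum_comm (s := Finset.univ (α := X))]
    _ ≤ (∑ q, ‖u q‖ ^ 2) * ∑ x, ∑ p, ‖Ω p x‖ ^ 2 := by
        gcongr with x
        exact hK fun p => Ω p x
    _ = _ := by rw [Finset.sum_comm]

/-- Kraus operators of the following map on `P X Y`: apply the map with Kraus operators `K w` to
`P`, project the reply `Q` together with `X` onto `φ`, and keep `B` and `Y`. -/
def acceptKraus [DecidableEq Y] (m : P × (X × Y) ≃ V) (φ : Q × X → ℂ) (K : W → Matrix (B × Q) P ℂ)
    (w : W) : Matrix (B × Y) V ℂ :=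
  Matrix.of fun c v => if (m.symm v).2.2 = c.2 then
    ∑ q, star (φ (q, (m.symm v).2.1)) * K w (c.1, q) (m.symm v).1 else 0

variable [DecidableEq Y] (m : P × (X × Y) ≃ V) (φ : Q × X → ℂ) (K : W → Matrix (B × Q) P ℂ)

theorem acceptKraus_mulVec (w : W) (Ψ : V → ℂ) (b : B) (y : Y) :
    (acceptKraus m φ K w *ᵥ Ψ) (b, y) =
      ∑ q : Q × X, star (φ q) * ∑ p, K w (b, q.1) p * Ψ (m (p, q.2, y)) := by
  rw [Matrix.mulVec, dotProduct, ← Equiv.sum_comp m]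
  simp only [acceptKraus, Matrix.of_apply, Equiv.symm_apply_apply, ite_mul, zero_mul,
    Fintype.sum_prod_type, Finset.sum_ite_eq', Finset.mem_univ, if_true, Finset.sum_mul,
    Finset.mul_sum]
  rw [Finset.sum_comm]
  conv_lhs => enter [2, x]; rw [Finset.sum_comm]
  rw [Finset.sum_comm]
  simp only [mul_assoc]

variable {m φ K}

/-- Nothing acts on Y, so testing with `v` contracts Y at once; what remains is the overlap bound
for the contracted vector, with ‖φ‖ = 1. -/
theorem traceFst_krausMap_acceptKraus_le
    (hφ : IsUnitVec φ)
    (hK : ∀ v : P → ℂ, ∑ w, ∑ e, ‖∑ p, K w e p * v p‖ ^ 2 ≤ ∑ p, ‖v p‖ ^ 2) (Ψ : V → ℂ) :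
    traceFst (krausMap (acceptKraus m φ K) (proj Ψ)) ≤
      traceFst (proj fun a : (P × X) × Y => Ψ (m (a.1.1, a.1.2, a.2))) := by
  rw [Matrix.le_iff, krausMap_proj, traceFst_sum]
  refine Matrix.PosSemidef.of_dotProduct_mulVec_nonneg ?_ fun v => ?_
  · exact (traceFst_posSemidef (Matrix.posSemidef_vecMulVec_self_star _)).isHermitian.sub
      (Matrix.posSemidef_sum _ fun w _ =>
        traceFst_posSemidef (Matrix.posSemidef_vecMulVec_self_star _)).isHermitian
  · rw [Matrix.sub_mulVec, dotProduct_sub, Matrix.sum_mulVec, dotProduct_sum, sub_nonneg]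
    simp only [dotProduct_traceFst_proj]
    rw [← Complex.ofReal_sum, Complex.real_le_real]
    have h := sum_norm_sq_overlap_le hK φ fun p x => ∑ y, star (v y) * Ψ (m (p, x, y))
    rw [hφ, one_mul] at h
    rw [Fintype.sum_prod_type]
    refine le_trans (le_of_eq ?_) h
    refine Finset.sum_congr rfl fun w _ => Finset.sum_congr rfl fun b _ => ?_
    congr 2
    simp only [acceptKraus_mulVec, Finset.mul_sum]
    rw [Finset.sum_comm]
    refine Finset.sum_congr rfl fun q _ => ?_
    rw [Finset.sum_comm]
    refine Finset.sum_congr rfl fun p _ => Finset.sum_congr rfl fun y _ => ?_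
    ring

theorem isCPTNI_acceptKraus [DecidableEq V] (hφ : IsUnitVec φ)
    (hK : ∀ v : P → ℂ, ∑ w, ∑ e, ‖∑ p, K w e p * v p‖ ^ 2 ≤ ∑ p, ‖v p‖ ^ 2) :
    IsCPTNI (krausMap (acceptKraus m φ K)) := by
  refine isCPTNI_krausMap fun Ψ => ?_
  have h := (Complex.nonneg_iff.mp
    (Matrix.le_iff.mp (traceFst_krausMap_acceptKraus_le (m := m) hφ hK Ψ)).trace_nonneg).1
  rw [Matrix.trace_sub, Complex.sub_re, sub_nonneg, trace_traceFst, trace_traceFst, trace_proj,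
    trace_re_krausMap_proj, Complex.ofReal_re] at h
  refine h.trans_eq ?_
  rw [← Equiv.sum_comp m]
  simp only [Fintype.sum_prod_type]

/-- The hypothesis says ⟨φ| = ⟨u|(1 ⊗ L). As L acts on X and the Kraus operators on P, L passes
through to Ψ before the overlap bound is used. -/
theorem trace_krausMap_acceptKraus_le
    (hK : ∀ v : P → ℂ, ∑ w, ∑ e, ‖∑ p, K w e p * v p‖ ^ 2 ≤ ∑ p, ‖v p‖ ^ 2) (Ψ : V → ℂ)
    (u : Q × X → ℂ) (L : Matrix X X ℂ)
    (hφ : ∀ q x, star (φ (q, x)) = ∑ x', star (u (q, x')) * L x' x) :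
    (krausMap (acceptKraus m φ K) (proj Ψ)).trace.re ≤
      (∑ q, ‖u q‖ ^ 2) * ∑ y, ∑ p, ∑ x, ‖∑ x', L x x' * Ψ (m (p, x', y))‖ ^ 2 := by
  rw [trace_re_krausMap_proj, Finset.mul_sum]
  simp only [Fintype.sum_prod_type (γ := ℝ) (α₁ := B)]
  have h : ∀ y, _ := fun y =>
    sum_norm_sq_overlap_le hK u fun p x => ∑ x', L x x' * Ψ (m (p, x', y))
  refine le_trans (le_of_eq ?_) (Finset.sum_le_sum fun y _ => h y)
  rw [Finset.sum_comm (s := Finset.univ (α := Y))]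
  refine Finset.sum_congr rfl fun w _ => ?_
  rw [Finset.sum_comm (s := Finset.univ (α := Y))]
  refine Finset.sum_congr rfl fun b _ => Finset.sum_congr rfl fun y _ => ?_
  congr 2
  rw [acceptKraus_mulVec]
  simp only [Fintype.sum_prod_type, hφ, Finset.mul_sum, Finset.sum_mul]
  refine Finset.sum_congr rfl fun q _ => ?_
  conv_lhs => enter [2, x]; rw [Finset.sum_comm]
  rw [Finset.sum_comm]
  refine Finset.sum_congr rfl fun x' _ => ?_
  rw [Finset.sum_comm]
  refine Finset.sum_congr rfl fun p _ => Finset.sum_congr rfl fun x _ => ?_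
  ring

end Acceptance

/-! ### Permutation invariant operators -/

section Permutations

variable {X : Type*} [Fintype X] [DecidableEq X] {N : ℕ}

theorem permOp_mulVec (π : Equiv.Perm (Fin N)) (ψ : (Fin N → X) → ℂ) (x : Fin N → X) :
    (permOp π *ᵥ ψ) x = ψ (x ∘ π) := by
  rw [Matrix.mulVec, dotProduct, Finset.sum_eq_single (x ∘ π)]
  · have : x = (x ∘ π) ∘ ⇑π⁻¹ := by ext i; simp
    simp only [permOp, Matrix.of_apply, if_pos this, one_mul]
  · intro y _ hy
    have : x ≠ y ∘ ⇑π⁻¹ := by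
      rintro rfl
      exact hy (by ext i; simp)
    simp only [permOp, Matrix.of_apply, if_neg this, zero_mul]
  · simp

theorem permConj_apply (π : Equiv.Perm (Fin N)) (M : Matrix (Fin N → X) (Fin N → X) ℂ)
    (x y : Fin N → X) : permConj π M x y = M (x ∘ π) (y ∘ π) := by
  have h1 : ∀ (L : Matrix (Fin N → X) (Fin N → X) ℂ) x y,
      (permOp π * L : Matrix (Fin N → X) (Fin N → X) ℂ) x y = L (x ∘ π) y :=
    fun L x y => permOp_mulVec π (fun z => L z y) x
  have h2 : M * (permOp π)ᴴ = (permOp π * Mᴴ)ᴴ := by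
    rw [Matrix.conjTranspose_mul, Matrix.conjTranspose_conjTranspose]
  rw [permConj, mul_assoc, h1, h2, Matrix.conjTranspose_apply, h1, Matrix.conjTranspose_apply,
    star_star]

theorem symmetrize_apply (M : Matrix (Fin N → X) (Fin N → X) ℂ) (x y : Fin N → X) :
    symmetrize M x y = (N.factorial : ℂ)⁻¹ * ∑ π : Equiv.Perm (Fin N), M (x ∘ π) (y ∘ π) := by
  simp [symmetrize, Matrix.sum_apply, permConj_apply]

theorem symmetrize_apply_comp (M : Matrix (Fin N → X) (Fin N → X) ℂ) (π : Equiv.Perm (Fin N))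
    (x y : Fin N → X) : symmetrize M (x ∘ π) (y ∘ π) = symmetrize M x y := by
  rw [symmetrize_apply, symmetrize_apply]
  conv_rhs => rw [← Equiv.sum_comp (Equiv.mulLeft π)]
  rfl

/-- Uniqueness of the positive square root: the reindexed root is again a positive root of the same
matrix. -/
theorem sqrt_apply_comp {M : Matrix (Fin N → X) (Fin N → X) ℂ} (hM : M.PosSemidef)
    (π : Equiv.Perm (Fin N)) (hinv : ∀ x y, M (x ∘ π) (y ∘ π) = M x y) (x y : Fin N → X) :
    CFC.sqrt M (x ∘ π) (y ∘ π) = CFC.sqrt M x y := by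
  let e : (Fin N → X) ≃ (Fin N → X) := π.symm.arrowCongr (Equiv.refl X)
  have h : CFC.sqrt M = (CFC.sqrt M).submatrix e e := by
    refine CFC.sqrt_unique ?_ ?_
    · rw [Matrix.submatrix_mul_equiv, sqrt_mul_sqrt hM]
      ext x y
      exact hinv x y
    · exact ((Matrix.nonneg_iff_posSemidef.mp (CFC.sqrt_nonneg M)).submatrix e).nonneg
  conv_rhs => rw [h]
  rfl

end Permutations

/-! ### The symmetric purification -/

section Purify

variable {P S : Type*} [Fintype P] [DecidableEq P] [Fintype S] [DecidableEq S] {N : ℕ}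

/-- The vector `∑_z |ι z⟩ ⊗ √τ |z⟩` on `(P ⊗ S)^{⊗N}`. -/
noncomputable def purify (ι : S → P) (τ : Matrix (Fin N → S) (Fin N → S) ℂ) :
    (Fin N → P × S) → ℂ := fun q =>
  Function.extend (fun z : Fin N → S => ι ∘ z) (CFC.sqrt τ fun i => (q i).2) 0 fun i => (q i).1

theorem purify_mem_symSubspace {ι : S → P} (hι : Function.Injective ι)
    {τ : Matrix (Fin N → S) (Fin N → S) ℂ} (hτ : τ.PosSemidef)
    (hinv : ∀ (π : Equiv.Perm (Fin N)) x y, τ (x ∘ π) (y ∘ π) = τ x y) :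
    purify ι τ ∈ symSubspace N (P × S) := by
  refine Submodule.subset_span fun π => ?_
  ext q
  rw [permOp_mulVec]
  simp only [purify, Function.comp_def]
  have hj : Function.Injective (fun z : Fin N → S => fun i => ι (z i)) := hι.comp_left
  by_cases h : ∃ z : Fin N → S, (fun i => ι (z i)) = fun i => (q i).1
  · obtain ⟨z, hz⟩ := h
    have hz' : (fun i => (q (π i)).1) = fun i => ι ((z ∘ π) i) :=
      funext fun i => (congrFun hz (π i)).symm
    rw [hz', ← hz]
    refine (hj.extend_apply _ _ _).trans (Eq.trans ?_ (hj.extend_apply _ _ _).symm)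
    exact sqrt_apply_comp hτ π (hinv π) (fun i => (q i).2) z
  -- The range of `ι ∘ ·` is stable under permuting positions, so off it both sides vanish.
  · rw [Function.extend_apply' _ _ _ h, Function.extend_apply']
    · rfl
    · rintro ⟨z, hz⟩
      exact h ⟨z ∘ ⇑π⁻¹, funext fun i => by simpa using congrFun hz (π⁻¹ i)⟩

theorem tracePN_proj_purify {ι : S → P} (hι : Function.Injective ι)
    {τ : Matrix (Fin N → S) (Fin N → S) ℂ} (hτ : τ.PosSemidef) :
    tracePN (proj (purify ι τ)) = τ := by
  have hj : Function.Injective (fun z : Fin N → S => ι ∘ z) := hι.comp_left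
  ext s s'
  simp only [tracePN, proj, Matrix.of_apply, Matrix.vecMulVec_apply, Pi.star_apply, purify]
  rw [sum_extend_mul hj _ fun p => star (Function.extend (fun z : Fin N → S => ι ∘ z)
    (CFC.sqrt τ s') 0 p)]
  conv_rhs => rw [← sqrt_mul_sqrt hτ]
  nth_rewrite 4 [← sqrt_isHermitian τ]
  simp only [hj.extend_apply, Matrix.mul_apply, Matrix.conjTranspose_apply]

end Purify

/-! ### Samples and permutations of the positions -/

section Samples

variable {S : Type*} {N k : ℕ}

theorem group_apply (t : Sample N k) (z : Fin N → S) :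
    group t S z = (fun i => z (positions t (Sum.inl i)), fun i => z (positions t (Sum.inr i))) :=
  rfl

theorem group_symm_inl (t : Sample N k) (u : (Fin k → S) × (Fin (N - k) → S)) (i : Fin k) :
    (group t S).symm u (positions t (Sum.inl i)) = u.1 i :=
  congrFun (congrArg Prod.fst ((group t S).apply_symm_apply u)) i

theorem group_symm_inr (t : Sample N k) (u : (Fin k → S) × (Fin (N - k) → S)) (i : Fin (N - k)) :
    (group t S).symm u (positions t (Sum.inr i)) = u.2 i :=
  congrFun (congrArg Prod.snd ((group t S).apply_symm_apply u)) i

theorem prod_positions {M : Type*} [CommMonoid M] (t : Sample N k) (f : Fin N → M) :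
    ∏ i, f i = (∏ i, f (positions t (Sum.inl i))) * ∏ i, f (positions t (Sum.inr i)) := by
  rw [← Equiv.prod_comp (positions t), Fintype.prod_sum_type]

/-- The permutation which moves the positions in `t` to those in `t₀`, and the others to those
outside `t₀`, reordering them by `a` and `b`. -/
def samplePerm (t₀ t : Sample N k) (a : Equiv.Perm (Fin k)) (b : Equiv.Perm (Fin (N - k))) :
    Equiv.Perm (Fin N) :=
  (positions t).symm.trans ((Equiv.sumCongr a b).trans (positions t₀))

theorem positions_inl_mem (t : Sample N k) (i : Fin k) : positions t (Sum.inl i) ∈ t.1 := by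
  simp [positions, finSumEquivOfFinset_inl]

theorem positions_inr_notMem (t : Sample N k) (i : Fin (N - k)) :
    positions t (Sum.inr i) ∉ t.1 := by
  have : positions t (Sum.inr i) ∈ t.1ᶜ := by
    simp only [positions, finSumEquivOfFinset_inr]
    exact Finset.orderEmbOfFin_mem _ _ _
  exact Finset.mem_compl.mp this

theorem samplePerm_mem_iff (t₀ t : Sample N k) (a : Equiv.Perm (Fin k))
    (b : Equiv.Perm (Fin (N - k))) (i : Fin N) : samplePerm t₀ t a b i ∈ t₀.1 ↔ i ∈ t.1 := by
  obtain ⟨j, rfl⟩ := (positions t).surjective i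
  rcases j with j | j
  · simp [samplePerm, positions_inl_mem]
  · simp [samplePerm, positions_inr_notMem]

/-- The sample is recovered as the preimage of `t₀`, then the two orders are read off; surjectivity
is the count C(N,k) k! (N-k)! = N!. -/
theorem samplePerm_bijective (hk : k ≤ N) (t₀ : Sample N k) : Function.Bijective
    (fun u : Sample N k × Equiv.Perm (Fin k) × Equiv.Perm (Fin (N - k)) =>
      samplePerm t₀ u.1 u.2.1 u.2.2) := by
  rw [Fintype.bijective_iff_injective_and_card]
  constructor
  · rintro ⟨t, a, b⟩ ⟨t', a', b'⟩ h
    simp only at h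
    obtain rfl : t = t' := by
      ext i
      rw [← samplePerm_mem_iff t₀ t a b, h, samplePerm_mem_iff]
    have h1 : ∀ j, Equiv.sumCongr a b j = Equiv.sumCongr a' b' j := fun j => by
      have := congrFun (congrArg DFunLike.coe h) (positions t j)
      simpa [samplePerm] using this
    have ha : a = a' := Equiv.ext fun i => by simpa using h1 (Sum.inl i)
    have hb : b = b' := Equiv.ext fun i => by simpa using h1 (Sum.inr i)
    rw [ha, hb]
  · rw [Fintype.card_prod, Fintype.card_prod, Fintype.card_perm, Fintype.card_perm,
      Fintype.card_perm, Fintype.card_finset_len, Fintype.card_fin, Fintype.card_fin,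
      Fintype.card_fin, ← mul_assoc, Nat.choose_mul_factorial_mul_factorial hk]

theorem group_comp_samplePerm (t₀ t : Sample N k) (a : Equiv.Perm (Fin k))
    (b : Equiv.Perm (Fin (N - k))) (z : Fin N → S) :
    group t S (z ∘ samplePerm t₀ t a b) = ((group t₀ S z).1 ∘ a, (group t₀ S z).2 ∘ b) := by
  simp [group_apply, samplePerm, Function.comp_def]

theorem nonempty_sample (hk : k ≤ N) : Nonempty (Sample N k) := by
  obtain ⟨t, -, ht⟩ := Finset.exists_subset_card_eq (s := (Finset.univ : Finset (Fin N)))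
    (n := k) (by simpa using hk)
  exact ⟨⟨t, ht⟩⟩

end Samples

/-! ### The shuffled state of an attack -/

section Shuffle

variable {A S : Type*} [Fintype A] [DecidableEq A] [Fintype S] [DecidableEq S] {N k : ℕ}

theorem IsCP.posSemidef_ampliate {X Y E : Type*} [Fintype X] [Fintype Y] [Fintype E]
    {Φ : Matrix X X ℂ →ₗ[ℂ] Matrix Y Y ℂ} (hΦ : IsCP Φ) {M : Matrix (X × E) (X × E) ℂ}
    (hM : M.PosSemidef) : (ampliate Φ M).PosSemidef := by
  let e := Fintype.equivFin E
  have h := (hΦ _ _ (hM.submatrix (Prod.map id e.symm))).submatrix (Prod.map id e)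
  convert h using 1
  ext p q
  simp [ampliate]

/-- No signalling: a trace-preserving map on the prover's register leaves the sampler's state alone.
-/
theorem traceFst_ampliate {X Y E : Type*} [Fintype X] [Fintype Y] [Fintype E]
    {Φ : Matrix X X ℂ →ₗ[ℂ] Matrix Y Y ℂ} (hΦ : ∀ M, (Φ M).trace = M.trace)
    (M : Matrix (X × E) (X × E) ℂ) : traceFst (ampliate Φ M) = traceFst M := by
  ext x y
  exact hΦ (Matrix.of fun a a' => M (a, x) (a', y))

/-- The states `B t` of `A^k S^k S^n`, for random `t`, with the `k` pairs and the `n` remaining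
registers reordered at random; the order of the latter is recorded, and the registers `S^k S^n`
are moved to the positions inside and outside `t₀`. -/
noncomputable def shuffledState (t₀ : Sample N k)
    (B : Sample N k → Matrix (((Fin k → A) × (Fin k → S)) × (Fin (N - k) → S))
      (((Fin k → A) × (Fin k → S)) × (Fin (N - k) → S)) ℂ) :
    Matrix ((Equiv.Perm (Fin (N - k)) × (Fin k → A)) × (Fin N → S))
      ((Equiv.Perm (Fin (N - k)) × (Fin k → A)) × (Fin N → S)) ℂ :=
  (N.factorial : ℂ)⁻¹ • ∑ t, ∑ a : Equiv.Perm (Fin k),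
    ((1 : Matrix (Equiv.Perm (Fin (N - k))) (Equiv.Perm (Fin (N - k))) ℂ) ⊗ₖ B t).submatrix
      (fun c => (c.1.1, ((c.1.2 ∘ a, (group t₀ S c.2).1 ∘ a), (group t₀ S c.2).2 ∘ c.1.1)))
      (fun c => (c.1.1, ((c.1.2 ∘ a, (group t₀ S c.2).1 ∘ a), (group t₀ S c.2).2 ∘ c.1.1)))

variable {t₀ : Sample N k} {B : Sample N k → Matrix (((Fin k → A) × (Fin k → S)) ×
  (Fin (N - k) → S)) (((Fin k → A) × (Fin k → S)) × (Fin (N - k) → S)) ℂ}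

theorem posSemidef_shuffledState (hB : ∀ t, (B t).PosSemidef) :
    (shuffledState t₀ B).PosSemidef := by
  refine (Matrix.posSemidef_sum _ fun t _ => Matrix.posSemidef_sum _ fun a _ =>
    (Matrix.PosSemidef.one.kronecker (hB t)).submatrix _).smul ?_
  rw [← Complex.ofReal_natCast, ← Complex.ofReal_inv]
  exact Complex.zero_le_real.mpr (by positivity)

theorem shuffledState_apply (b b' : Equiv.Perm (Fin (N - k))) (α α' : Fin k → A)
    (z z' : Fin N → S) :
    shuffledState t₀ B ((b, α), z) ((b', α'), z') =
      (N.factorial : ℂ)⁻¹ * ∑ t, ∑ a : Equiv.Perm (Fin k), if b = b' then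
        B t ((α ∘ a, (group t₀ S z).1 ∘ a), (group t₀ S z).2 ∘ b)
          ((α' ∘ a, (group t₀ S z').1 ∘ a), (group t₀ S z').2 ∘ b') else 0 := by
  simp [shuffledState, Matrix.sum_apply, Matrix.one_apply]

/-- Each triple of sample and two orders contributes ρ permuted by `samplePerm`, and these triples
run through each permutation once. The hypothesis says that all `B t`, ungrouped, have the same
marginal ρ. -/
theorem traceFst_shuffledState (hk : k ≤ N) {ρ : Matrix (Fin N → S) (Fin N → S) ℂ}
    (hB : ∀ t z z', ∑ α, B t ((α, (group t S z).1), (group t S z).2)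
      ((α, (group t S z').1), (group t S z').2) = ρ z z') :
    traceFst (shuffledState t₀ B) = symmetrize ρ := by
  ext z z'
  rw [symmetrize_apply, ← (samplePerm_bijective hk t₀).sum_comp]
  simp only [traceFst, Matrix.of_apply, Fintype.sum_prod_type, shuffledState_apply, if_true,
    ← Finset.mul_sum]
  congr 1
  calc _ = ∑ b : Equiv.Perm (Fin (N - k)), ∑ t, ∑ a : Equiv.Perm (Fin k), ∑ α : Fin k → A,
        B t ((α ∘ a, (group t₀ S z).1 ∘ a), (group t₀ S z).2 ∘ b)
          ((α ∘ a, (group t₀ S z').1 ∘ a), (group t₀ S z').2 ∘ b) := by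
        refine Finset.sum_congr rfl fun b _ => ?_
        rw [Finset.sum_comm]
        exact Finset.sum_congr rfl fun t _ => Finset.sum_comm
    _ = ∑ b : Equiv.Perm (Fin (N - k)), ∑ t, ∑ a : Equiv.Perm (Fin k),
        ρ (z ∘ samplePerm t₀ t a b) (z' ∘ samplePerm t₀ t a b) := by
        refine Finset.sum_congr rfl fun b _ => Finset.sum_congr rfl fun t _ =>
          Finset.sum_congr rfl fun a _ => ?_
        rw [← hB t]
        conv_rhs => rw [← Equiv.sum_comp (a.symm.arrowCongr (Equiv.refl A))]
        simp only [group_comp_samplePerm]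
        rfl
    _ = _ := by
        rw [Finset.sum_comm]
        exact Finset.sum_congr rfl fun t _ => Finset.sum_comm

/-- The overlap of the shuffled state with a vector which is invariant under reordering of the `k`
pairs. -/
theorem sum_shuffledState (hk : k ≤ N) {φ : (Fin k → A) × (Fin k → S) → ℂ}
    (hφ : ∀ (a : Equiv.Perm (Fin k)) q, φ (q.1 ∘ a, q.2 ∘ a) = φ q)
    (b b' : Equiv.Perm (Fin (N - k))) (y y' : Fin (N - k) → S) :
    ∑ q, ∑ q', star (φ q) * φ q' * shuffledState t₀ B ((b, q.1), (group t₀ S).symm (q.2, y))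
        ((b', q'.1), (group t₀ S).symm (q'.2, y')) =
      if b = b' then ((N - k).factorial : ℂ)⁻¹ * ((N.choose k : ℂ)⁻¹ * ∑ t, ∑ q, ∑ q',
        star (φ q) * φ q' * B t (q, y ∘ b) (q', y' ∘ b')) else 0 := by
  split_ifs with hb
  · simp only [shuffledState_apply, if_pos hb, Equiv.apply_symm_apply]
    -- Relabelling q and q' by `a` is free because φ is invariant; the sum over `a` then gives k!,
    -- which reduces 1/N! to 1/((N-k)! C(N,k)).
    have hre : ∀ (t : Sample N k) (a : Equiv.Perm (Fin k)),
        ∑ q : (Fin k → A) × (Fin k → S), ∑ q' : (Fin k → A) × (Fin k → S),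
          star (φ q) * φ q' * B t ((q.1 ∘ a, q.2 ∘ a), y ∘ b) ((q'.1 ∘ a, q'.2 ∘ a), y' ∘ b') =
        ∑ q, ∑ q', star (φ q) * φ q' * B t (q, y ∘ b) (q', y' ∘ b') := by
      intro t a
      let e := (a.symm.arrowCongr (Equiv.refl A)).prodCongr (a.symm.arrowCongr (Equiv.refl S))
      have he : ∀ q, e q = (q.1 ∘ a, q.2 ∘ a) := fun q => rfl
      conv_rhs =>
        rw [← Equiv.sum_comp e]
        enter [2, q]
        rw [← Equiv.sum_comp e]
      simp only [he, hφ]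
    have hfac : (N.factorial : ℂ) = N.choose k * k.factorial * (N - k).factorial := by
      exact_mod_cast (Nat.choose_mul_factorial_mul_factorial hk).symm
    have hne : (k.factorial : ℂ) ≠ 0 := by exact_mod_cast k.factorial_ne_zero
    calc _ = (N.factorial : ℂ)⁻¹ * ∑ t, ∑ a : Equiv.Perm (Fin k),
          ∑ q : (Fin k → A) × (Fin k → S), ∑ q' : (Fin k → A) × (Fin k → S),
          star (φ q) * φ q' * B t ((q.1 ∘ a, q.2 ∘ a), y ∘ b) ((q'.1 ∘ a, q'.2 ∘ a), y' ∘ b') := by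
          simp only [Finset.mul_sum]
          conv_lhs =>
            enter [2, q]
            rw [Finset.sum_comm]
            enter [2, t]
            rw [Finset.sum_comm]
          rw [Finset.sum_comm]
          conv_lhs =>
            enter [2, t]
            rw [Finset.sum_comm]
          refine Finset.sum_congr rfl fun t _ => Finset.sum_congr rfl fun a _ =>
            Finset.sum_congr rfl fun q _ => Finset.sum_congr rfl fun q' _ => ?_
          ring
      _ = _ := by
          simp only [hre, Finset.sum_const, Finset.card_univ, Fintype.card_perm, Fintype.card_fin,
            nsmul_eq_mul, ← Finset.mul_sum, hfac, mul_inv]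
          field_simp
  · simp [shuffledState_apply, hb]

end Shuffle

/-! ### Product vectors and local filters -/

section TensorPowers

variable {A P S : Type*} [Fintype A] [Fintype P] [Fintype S] {N k : ℕ}

theorem sum_prod_pair {R : Type*} [CommSemiring R] (k : ℕ) (f : A × S → R) :
    ∑ a : Fin k → A, ∑ s : Fin k → S, ∏ i, f (a i, s i) = (∑ x, f x) ^ k := by
  rw [← Fintype.sum_prod_type' (f := fun (a : Fin k → A) (s : Fin k → S) => ∏ i, f (a i, s i)),
    ← Equiv.sum_comp (Equiv.arrowProdEquivProdArrow (Fin k) (fun _ => A) (fun _ => S))]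
  have h := Finset.prod_univ_sum (fun _ : Fin k => (Finset.univ : Finset (A × S))) fun _ => f
  rw [Fintype.piFinset_univ, Finset.prod_const, Finset.card_univ, Fintype.card_fin] at h
  exact h.symm

theorem sum_norm_sq_pairedPow (k : ℕ) (f : A × S → ℂ) :
    ∑ q, ‖pairedPow k f q‖ ^ 2 = (∑ x, ‖f x‖ ^ 2) ^ k := by
  rw [← sum_prod_pair, Fintype.sum_prod_type]
  simp [pairedPow, Finset.prod_pow]

/-- The vector `(1 ⊗ L) θ`. -/
def applySnd (L : Matrix S S ℂ) (θ : P × S → ℂ) : P × S → ℂ :=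
  fun x => ∑ s, L x.2 s * θ (x.1, s)

theorem sum_norm_sq_applySnd (L : Matrix S S ℂ) (θ : P × S → ℂ) :
    ∑ x, ‖applySnd L θ x‖ ^ 2 = (L * traceFst (proj θ) * Lᴴ).trace.re := by
  have h : L * traceFst (proj θ) * Lᴴ = traceFst (proj (applySnd L θ)) := by
    ext s s'
    simp only [Matrix.mul_apply, traceFst, proj, Matrix.of_apply, Matrix.vecMulVec_apply,
      applySnd, Pi.star_apply, Matrix.conjTranspose_apply, star_sum, star_mul', Finset.sum_mul,
      Finset.mul_sum]
    conv_lhs => enter [2, r]; rw [Finset.sum_comm]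
    rw [Finset.sum_comm]
    refine Finset.sum_congr rfl fun p _ => ?_
    refine Finset.sum_congr rfl fun r _ => Finset.sum_congr rfl fun r' _ => ?_
    ring
  rw [h, trace_traceFst, trace_proj, Complex.ofReal_re]

theorem sum_opPow_mul (L : Matrix S S ℂ) (f : Fin k → S → ℂ) (x : Fin k → S) :
    ∑ x', opPow k L x x' * ∏ i, f i (x' i) = ∏ i, ∑ s, L (x i) s * f i s := by
  simp only [opPow, Matrix.of_apply, ← Finset.prod_mul_distrib]
  rw [Finset.prod_univ_sum, Fintype.piFinset_univ]

/-- The registers `P^N S^k S^n` arranged as `(P S)^N`. -/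
def pairUp (t₀ : Sample N k) (P S : Type*) :
    (Fin N → P) × ((Fin k → S) × (Fin (N - k) → S)) ≃ (Fin N → P × S) :=
  ((Equiv.refl _).prodCongr (group t₀ S).symm).trans
    (Equiv.arrowProdEquivProdArrow (Fin N) (fun _ => P) (fun _ => S)).symm

theorem pairUp_apply (t₀ : Sample N k) (p : Fin N → P) (u : (Fin k → S) × (Fin (N - k) → S)) :
    pairUp t₀ P S (p, u) = fun i => (p i, (group t₀ S).symm u i) := rfl

theorem vecPow_pairUp (t₀ : Sample N k) (θ : P × S → ℂ) (p : Fin N → P) (x : Fin k → S)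
    (y : Fin (N - k) → S) :
    vecPow N θ (pairUp t₀ P S (p, x, y)) =
      pairedPow k θ ((group t₀ P p).1, x) * pairedPow (N - k) θ ((group t₀ P p).2, y) := by
  rw [vecPow, prod_positions t₀]
  simp only [pairUp_apply, group_symm_inl, group_symm_inr]
  rfl

/-- All of P^N is traced out: sampled positions contribute ‖θ‖² = 1 each, the others one factor θ_S
each. -/
theorem traceFst_proj_vecPow_pairUp (t₀ : Sample N k) {θ : P × S → ℂ} (hθ : IsUnitVec θ) :
    traceFst (proj fun a : ((Fin N → P) × (Fin k → S)) × (Fin (N - k) → S) =>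
      vecPow N θ (pairUp t₀ P S (a.1.1, a.1.2, a.2))) = opPow (N - k) (traceFst (proj θ)) := by
  ext y y'
  simp only [traceFst, proj, Matrix.of_apply, Matrix.vecMulVec_apply, Pi.star_apply,
    vecPow_pairUp, opPow, Fintype.sum_prod_type]
  rw [← Equiv.sum_comp (group t₀ P).symm]
  simp only [Equiv.apply_symm_apply, Fintype.sum_prod_type]
  have h1 : ∑ p : Fin k → P, ∑ x : Fin k → S,
      pairedPow k θ (p, x) * star (pairedPow k θ (p, x)) = 1 := by
    have h := ofReal_sum_norm_sq (pairedPow k θ)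
    rw [isUnitVec_pairedPow k hθ, dotProduct, Fintype.sum_prod_type] at h
    exact_mod_cast h.symm
  have h2 : ∑ p : Fin (N - k) → P, pairedPow (N - k) θ (p, y) * star (pairedPow (N - k) θ (p, y'))
      = ∏ i, ∑ p, θ (p, y i) * star (θ (p, y' i)) := by
    rw [Finset.prod_univ_sum, Fintype.piFinset_univ]
    simp [pairedPow, Finset.prod_mul_distrib]
  rw [← h2, ← one_mul (∑ p : Fin (N - k) → P, _), ← h1, Finset.sum_mul]
  refine Finset.sum_congr rfl fun p _ => ?_
  rw [Finset.sum_comm, Finset.sum_mul]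
  refine Finset.sum_congr rfl fun x _ => ?_
  rw [Finset.mul_sum]
  refine Finset.sum_congr rfl fun p' _ => ?_
  rw [star_mul']
  ring

/-- The filter meets only the k sampled factors; the remaining ones are normalized. -/
theorem sum_norm_sq_opPow_vecPow (t₀ : Sample N k) {θ : P × S → ℂ} (hθ : IsUnitVec θ)
    (L : Matrix S S ℂ) :
    ∑ y, ∑ p, ∑ x, ‖∑ x', opPow k L x x' * vecPow N θ (pairUp t₀ P S (p, x', y))‖ ^ 2 =
      (L * traceFst (proj θ) * Lᴴ).trace.re ^ k := by
  have h1 : ∀ y p x, ∑ x', opPow k L x x' * vecPow N θ (pairUp t₀ P S (p, x', y)) =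
      pairedPow k (applySnd L θ) ((group t₀ P p).1, x) *
        pairedPow (N - k) θ ((group t₀ P p).2, y) := by
    intro y p x
    simp only [vecPow_pairUp, ← mul_assoc, ← Finset.sum_mul]
    congr 1
    exact sum_opPow_mul L (fun i s => θ ((group t₀ P p).1 i, s)) x
  simp only [h1, norm_mul, mul_pow]
  conv_lhs =>
    enter [2, y]
    rw [← Equiv.sum_comp (group t₀ P).symm]
  simp only [Equiv.apply_symm_apply, Fintype.sum_prod_type, ← Finset.sum_mul]
  rw [← sum_norm_sq_applySnd, ← sum_norm_sq_pairedPow,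
    ← mul_one (∑ q, ‖pairedPow k (applySnd L θ) q‖ ^ 2), ← isUnitVec_pairedPow (N - k) hθ]
  simp only [Fintype.sum_prod_type]
  rw [Finset.sum_comm, Finset.sum_mul]
  refine Finset.sum_congr rfl fun p _ => ?_
  rw [Finset.sum_comm, Finset.mul_sum]
  refine Finset.sum_congr rfl fun p' _ => ?_
  rw [Finset.mul_sum]

/-- Inserts L⁻¹L in each factor, giving the splitting ⟨φ| = ⟨u|(1 ⊗ L) needed for the acceptance
bound. -/
theorem star_pairedPow_eq [DecidableEq S] (φ : A × S → ℂ) {L : Matrix S S ℂ} (hL : Lᴴ = L)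
    (hu : IsUnit L.det) (q : Fin k → A) (x : Fin k → S) :
    star (pairedPow k φ (q, x)) =
      ∑ x', star (pairedPow k (applySnd L⁻¹ φ) (q, x')) * opPow k L x' x := by
  have h : ∀ a s, star (φ (a, s)) = ∑ s', star (applySnd L⁻¹ φ (a, s')) * L s' s := by
    intro a s
    have hinv : L⁻¹ * L = 1 := Matrix.nonsing_inv_mul _ hu
    have hLi : (L⁻¹)ᴴ = L⁻¹ := by rw [Matrix.conjTranspose_nonsing_inv, hL]
    calc star (φ (a, s)) = ∑ r, star (φ (a, r)) * ((L⁻¹)ᴴ * L) r s := by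
          simp [hLi, hinv, Matrix.one_apply]
      _ = _ := by
          simp only [applySnd, star_sum, star_mul', Matrix.mul_apply, Finset.mul_sum,
            Finset.sum_mul, Matrix.conjTranspose_apply]
          rw [Finset.sum_comm]
          refine Finset.sum_congr rfl fun r _ => Finset.sum_congr rfl fun r' _ => ?_
          ring
  simp only [pairedPow, star_prod, h, opPow, Matrix.of_apply, ← Finset.prod_mul_distrib]
  rw [Finset.prod_univ_sum, Fintype.piFinset_univ]

end TensorPowers

/-! ### Permutation invariance of purification-based sampling -/

section Main

variable {A P S : Type*} [Fintype A] [DecidableEq A] [Fintype P] [DecidableEq P]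
  [Fintype S] [DecidableEq S] {N k : ℕ}

theorem posSemidef_proj {X : Type*} [Fintype X] (ψ : X → ℂ) : (proj ψ).PosSemidef :=
  Matrix.nonneg_iff_posSemidef.mp (proj_nonneg ψ)

theorem pairedPow_comp (φ : A × S → ℂ) (a : Equiv.Perm (Fin k)) (q : (Fin k → A) × (Fin k → S)) :
    pairedPow k φ (q.1 ∘ a, q.2 ∘ a) = pairedPow k φ q :=
  Equiv.prod_comp a fun i => φ (q.1 i, q.2 i)

theorem traceFst_proj_kronecker_mul {X Y : Type*} [Fintype X] [Fintype Y] [DecidableEq Y]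
    (φ : X → ℂ) (M : Matrix (X × Y) (X × Y) ℂ) (y y' : Y) :
    traceFst ((proj φ ⊗ₖ (1 : Matrix Y Y ℂ)) * M) y y' =
      ∑ q, ∑ q', star (φ q) * φ q' * M (q, y) (q', y') := by
  simp only [traceFst, Matrix.of_apply, Matrix.mul_apply, Fintype.sum_prod_type,
    Matrix.kroneckerMap_apply, proj, Matrix.vecMulVec_apply, Matrix.one_apply, mul_ite, ite_mul,
    mul_one, mul_zero, zero_mul, Finset.sum_ite_eq, Finset.mem_univ, if_true, Pi.star_apply]
  rw [Finset.sum_comm]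
  refine Finset.sum_congr rfl fun q _ => Finset.sum_congr rfl fun q' _ => ?_
  ring

theorem randomReorder_apply {n : ℕ} (M : Matrix (Fin n → S) (Fin n → S) ℂ)
    (b b' : Equiv.Perm (Fin n)) (y y' : Fin n → S) :
    randomReorder M (b, y) (b', y') =
      if b = b' then (n.factorial : ℂ)⁻¹ * M (y ∘ b) (y' ∘ b') else 0 := by
  simp only [randomReorder, Matrix.smul_apply, Matrix.sum_apply, Matrix.kroneckerMap_apply,
    permConj_apply, smul_eq_mul, Matrix.single_apply]
  split_ifs with h
  · subst h
    rw [Finset.sum_eq_single b]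
    · simp
    · intro c _ hc
      simp [hc]
    · simp
  · rw [Finset.sum_eq_zero, mul_zero]
    intro c _
    rw [if_neg, zero_mul]
    rintro ⟨rfl, rfl⟩
    exact h rfl

theorem accMap_purificationSampling_apply {φ : A × S → ℂ} {hφ : IsUnitVec φ} {R : Type*}
    [Fintype R] (Att : Strategy (purificationSampling φ hφ N k) R)
    (ρ : Matrix (R × (Fin N → S)) (R × (Fin N → S)) ℂ) (y y' : Fin (N - k) → S) :
    accMap Att ρ y y' = (N.choose k : ℂ)⁻¹ * ∑ t, ∑ q : (Fin k → A) × (Fin k → S),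
      ∑ q' : (Fin k → A) × (Fin k → S), star (pairedPow k φ q) * pairedPow k φ q' *
        beforeMeasurement Att t () ρ (q, y) (q', y') := by
  rw [accMap, Matrix.smul_apply, Matrix.sum_apply, smul_eq_mul]
  congr 1
  refine Finset.sum_congr rfl fun t _ => ?_
  have h : ∀ f : Unit → Matrix (Fin (N - k) → S) (Fin (N - k) → S) ℂ,
      (∑ c, (((purificationSampling φ hφ N k).prob t c : ℝ) : ℂ) • f c) = f () := by
    intro f
    simp only [purificationSampling, Complex.ofReal_one, one_smul]
    exact Fintype.sum_unique f
  exact (congrFun (congrFun (h _) y) y').trans (traceFst_proj_kronecker_mul _ _ y y')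

theorem posSemidef_beforeMeasurement {prot : SamplingProtocol S N k} {R : Type*} [Fintype R]
    (Att : Strategy prot R) (t : Sample N k) (c : prot.C)
    {ρ : Matrix (R × (Fin N → S)) (R × (Fin N → S)) ℂ} (hρ : ρ.PosSemidef) :
    (beforeMeasurement Att t c ρ).PosSemidef :=
  ((Att.isCPTP t c).1.posSemidef_ampliate hρ).submatrix _

theorem sum_beforeMeasurement {prot : SamplingProtocol S N k} {R : Type*} [Fintype R]
    (Att : Strategy prot R) (t : Sample N k) (c : prot.C)
    (ρ : Matrix (R × (Fin N → S)) (R × (Fin N → S)) ℂ) (z z' : Fin N → S) :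
    ∑ α, beforeMeasurement Att t c ρ ((α, (group t S z).1), (group t S z).2)
      ((α, (group t S z').1), (group t S z').2) = traceFst ρ z z' := by
  rw [← traceFst_ampliate (Att.isCPTP t c).2 ρ]
  simp [beforeMeasurement, traceFst]

/-- The state obtained from the standard purification by the accepting Kraus operators. -/
theorem krausMap_acceptKraus_purify {E Q : Type*} [Fintype E] [DecidableEq E] [Fintype Q]
    [DecidableEq Q] {ι : S → P} {t₀ : Sample N k} {φ : Q × (Fin k → S) → ℂ}
    {σ : Matrix ((E × Q) × (Fin N → S)) ((E × Q) × (Fin N → S)) ℂ} (hσ : σ.PosSemidef)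
    {K : (E × Q) × (Fin N → S) → Matrix (E × Q) (Fin N → P) ℂ}
    (hK : ∀ w e z, ∑ p, K w e p *
      Function.extend (fun z : Fin N → S => ι ∘ z) (CFC.sqrt (traceFst σ) z) 0 p =
        CFC.sqrt σ (e, z) w) (b b' : E) (y y' : Fin (N - k) → S) :
    krausMap (acceptKraus (pairUp t₀ P S) φ K) (proj (purify ι (traceFst σ))) (b, y) (b', y') =
      ∑ q, ∑ q', star (φ q) * φ q' * σ ((b, q.1), (group t₀ S).symm (q.2, y))
        ((b', q'.1), (group t₀ S).symm (q'.2, y')) := by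
  have h : ∀ w b y, (acceptKraus (pairUp t₀ P S) φ K w *ᵥ purify ι (traceFst σ)) (b, y) =
      ∑ q, star (φ q) * CFC.sqrt σ ((b, q.1), (group t₀ S).symm (q.2, y)) w := by
    intro w b y
    rw [acceptKraus_mulVec]
    refine Finset.sum_congr rfl fun q _ => ?_
    rw [← hK]
    rfl
  have hs : ∀ c c', σ c c' = ∑ w, CFC.sqrt σ c w * star (CFC.sqrt σ c' w) := by
    intro c c'
    conv_lhs => rw [← sqrt_mul_sqrt hσ]
    nth_rewrite 2 [← sqrt_isHermitian σ]
    rfl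
  rw [krausMap_proj, Matrix.sum_apply]
  simp only [proj, Matrix.vecMulVec_apply, Pi.star_apply, h, hs, star_sum, star_mul', star_star,
    Finset.mul_sum, Finset.sum_mul]
  rw [Finset.sum_comm]
  conv_lhs => enter [2, q]; rw [Finset.sum_comm]
  rw [Finset.sum_comm]
  refine Finset.sum_congr rfl fun q _ => Finset.sum_congr rfl fun q' _ =>
    Finset.sum_congr rfl fun w _ => ?_
  ring

/-- The rate at which the acceptance probability decays is `ε` per sampled register. -/
theorem criterion2_acceptKraus {W : Type*} [Fintype W]
    {K : W → Matrix (Equiv.Perm (Fin (N - k)) × (Fin k → A)) (Fin N → P) ℂ}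
    (hK : ∀ v : (Fin N → P) → ℂ, ∑ w, ∑ e, ‖∑ p, K w e p * v p‖ ^ 2 ≤ ∑ p, ‖v p‖ ^ 2)
    (t₀ : Sample N k) (φ : A × S → ℂ) :
    Criterion2 P (traceFst (proj φ)) (fun ε => ε * k)
      (krausMap (acceptKraus (pairUp t₀ P S) (pairedPow k φ) K)) := by
  intro ε hε θ hθ hF
  obtain ⟨L, hL, hu, hle⟩ := exists_invertible_trace_mul_le
    (traceFst_posSemidef (posSemidef_proj θ))
    (traceFst_posSemidef (posSemidef_proj φ)) hF
  have hb := trace_krausMap_acceptKraus_le (m := pairUp t₀ P S) (φ := pairedPow k φ) hK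
    (vecPow N θ) (pairedPow k (applySnd L⁻¹ φ)) (opPow k L) (star_pairedPow_eq φ hL hu)
  rw [sum_norm_sq_opPow_vecPow t₀ hθ, sum_norm_sq_pairedPow, sum_norm_sq_applySnd,
    ← mul_pow] at hb
  rw [traceNorm_of_posSemidef
    (posSemidef_krausMap _ (posSemidef_proj _))]
  refine hb.trans ?_
  rw [← neg_mul, mul_comm (-ε), Real.exp_nat_mul]
  refine pow_le_pow_left₀ ?_ ?_ k
  · rw [← sum_norm_sq_applySnd, ← sum_norm_sq_applySnd]
    positivity
  -- The base is at most 1 - ε ≤ exp(-ε).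
  · rw [mul_comm]
    refine hle.trans ?_
    have := Real.add_one_le_exp (-ε)
    linarith

theorem permutationInvariant_purificationSampling
    (hPS : Fintype.card S ≤ Fintype.card P)
    (φ : A × S → ℂ) (hφ : IsUnitVec φ)
    (k : ℕ → ℕ) (hk : ∀ N, k N ≤ N)
    (hkN : ∃ β : ℝ, 0 < β ∧ ∀ᶠ N : ℕ in Filter.atTop, β * N ≤ k N) :
    PermutationInvariant P (traceFst (proj φ)) k
      (fun N => purificationSampling φ hφ N (k N)) := by
  obtain ⟨β, hβ, hβk⟩ := hkN
  obtain ⟨ι⟩ := Function.Embedding.nonempty_of_card_le hPS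
  refine ⟨fun ε N => ε * k N, fun ε hε => ⟨ε * β, by positivity, ?_⟩, ?_⟩
  · filter_upwards [hβk] with N hN
    rw [mul_assoc]
    exact mul_le_mul_of_nonneg_left hN hε.le
  · intro N R _ Att ρ hρ
    -- Any sample will do: it only fixes which positions of S^N are tested after the shuffle.
    obtain ⟨t₀⟩ := nonempty_sample (hk N)
    let B : Sample N (k N) → Matrix (((Fin (k N) → A) × (Fin (k N) → S)) × (Fin (N - k N) → S))
        (((Fin (k N) → A) × (Fin (k N) → S)) × (Fin (N - k N) → S)) ℂ :=
      fun t => beforeMeasurement Att t () ρ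
    have hσ : (shuffledState t₀ B).PosSemidef :=
      posSemidef_shuffledState fun t => posSemidef_beforeMeasurement Att t () hρ.1
    have hτ : traceFst (shuffledState t₀ B) = symmetrize (traceFst ρ) :=
      traceFst_shuffledState (hk N) fun t z z' => sum_beforeMeasurement Att t () ρ z z'
    have hj : Function.Injective fun z : Fin N → S => ι ∘ z := ι.injective.comp_left
    obtain ⟨K, hK, hKσ⟩ := exists_kraus_of_extension hσ hj
    have hφk := isUnitVec_pairedPow (k N) hφ
    refine ⟨krausMap (acceptKraus (pairUp t₀ P S) (pairedPow (k N) φ) K),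
      isCPTNI_acceptKraus hφk hK, ⟨purify ι (traceFst (shuffledState t₀ B)), ?_, ?_, ?_⟩,
      criterion2_acceptKraus hK t₀ φ, fun θ hθ => ?_⟩
    · refine purify_mem_symSubspace ι.injective (traceFst_posSemidef hσ) fun π x y => ?_
      rw [hτ, symmetrize_apply_comp]
    · rw [tracePN_proj_purify ι.injective (traceFst_posSemidef hσ), hτ]
    · ext ⟨b, y⟩ ⟨b', y'⟩
      -- On the purification the map yields the φ^{⊗k}-overlap of σ, diagonal in Π, with entry b
      -- carrying the accepted output reordered by b and weighted 1/n!.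
      rw [krausMap_acceptKraus_purify hσ hKσ, sum_shuffledState (hk N) (pairedPow_comp φ),
        randomReorder_apply, accMap_purificationSampling_apply]
      rfl
    · exact (traceFst_krausMap_acceptKraus_le hφk hK _).trans_eq
        (traceFst_proj_vecPow_pairUp t₀ hθ)

end Main

end QSampling

theorem mainTheorem5 {A P S : Type*} [Fintype A] [DecidableEq A] [Fintype P] [DecidableEq P]
    [Fintype S] [DecidableEq S]
    (hPS : Fintype.card S ≤ Fintype.card P)
    (φ : A × S → ℂ) (hφ : QSampling.IsUnitVec φ)
    (k : ℕ → ℕ) (hk : ∀ N, k N ≤ N)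
    (hkN : ∃ β : ℝ, 0 < β ∧ ∀ᶠ N : ℕ in Filter.atTop, β * N ≤ k N) :
    QSampling.PermutationInvariant P (QSampling.traceFst (QSampling.proj φ)) k
      (fun N => QSampling.purificationSampling φ hφ N (k N)) := by
  exact QSampling.permutationInvariant_purificationSampling hPS φ hφ k hk hkN
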